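/- **Conventions.** An MV algebra $(A,\oplus,\odot,\neg,0,1)$ is ordered by $a\le b\iff a\odot\neg b=0$, and $a\to b=\neg a\oplus b$. On $[0,1]$ we use $x\oplus y=\min(x+y,1)$, $x\odot y=\max(x+y-1,0)$, $\neg x=1-x$; let $L=[0,1]\cap\mathbb Q$. A *Pavelka algebra* is an MV algebra with constants $\bar r$ ($r\in L$) such that $\bar 0=0$, $\overline{r\oplus s}=\bar r\oplus\bar s$, $\overline{\neg r}=\neg\bar r$. An *existential quantifier* is a map $\exists$ with $\exists 0=0$, $a\le\exists a$, $\exists(a\odot\exists b)=\exists a\odot\exists b$, $\exists(a\oplus\exists b)=\exists a\oplus\exists b$, $\exists(a\odot a)=\exists a\odot\exists a$, $\exists(a\oplus a)=\exists a\oplus\exists a$, $\exists\bar r=\bar r$. Let $\alpha$ be an ordinal. For $i,j\in\alpha$, $[i|j]:\alpha\to\alpha$ maps $i$ to $j$ and fixes all other points; let $G$ be the semigroup (with identity) generated by these replacements. An *MV substitution algebra* ($\mathsf{SA}_\alpha$) is a Pavelka algebra with existential quantifiers $\mathsf c_i$ and MV endomorphisms $\mathsf s_{[i|j]}$ $(i,j\in\alpha)$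 such that, for $\tau=[i_1|j_1]\circ\cdots\circ[i_n|j_n]\in G$, the operation $\mathsf s_\tau=\mathsf s_{[i_1|j_1]}\cdots\mathsf s_{[i_n|j_n]}$ depends only on $\tau$ (and $\mathsf s_{Id}x=x$), and $\mathsf c_i\mathsf c_ix=\mathsf c_ix$, $\mathsf c_i\neg\mathsf c_ix=\neg\mathsf c_ix$, $\mathsf c_i\mathsf c_jx=\mathsf c_j\mathsf c_ix$; $\mathsf s_\tau\mathsf c_ix=\mathsf s_{\tau'}\mathsf c_ix$ if $\tau,\tau'\in G$ and $\tau'$ agrees with $\tau$ off $i$; $\mathsf s_\tau\mathsf c_ix=\mathsf c_j\mathsf s_\tau x$ if $\tau\in G$ and $\tau^{-1}(j)=\{i\}$; $\mathsf c_i\mathsf s_{[i|j]}x=\mathsf s_{[i|j]}x$ if $i\ne j$; $\mathsf s_{[i|j]}\mathsf c_ix=\mathsf c_ix$; $\mathsf s_{[i|j]}\mathsf c_kx=\mathsf c_k\mathsf s_{[i|j]}x$ if $k\notin\{i,j\}$; $\mathsf c_i\mathsf s_{[j|i]}x=\mathsf c_j\mathsf s_{[i|j]}x$. Put $\Delta x=\{i\in\alpha:\mathsf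 c_ix\ne x\}$. The algebra is *dimension complemented* if $\alpha\setminus\Delta x$ is infinite for every $x$. Let $V$ be the set of finite transformations of $\alpha$ (maps $\alpha\to\alpha$ moving only finitely many points). For $x\in V$ moving exactly $u_0<\dots<u_{k-1}$, with $v_i=x(u_i)$, and an element $p$, let $\pi_0<\dots<\pi_{k-1}$ be the first $k$ elements of $\alpha\setminus(\Delta p\cup\{u_i\}\cup\{v_i\})$ and put $\mathsf s_xp=\mathsf s_{[\pi_0|v_0]}\cdots\mathsf s_{[\pi_{k-1}|v_{k-1}]}\mathsf s_{[u_0|\pi_0]}\cdots\mathsf s_{[u_{k-1}|\pi_{k-1}]}p$. Let $\mathfrak F(V,[0,1])$ be the algebra of all functions $f:V\to[0,1]$ with pointwise MV operations and constants $\bar r(x)=r$, with $\mathsf c_if(x)=\bigvee\{f(y):y\in V,\ y(j)=x(j)\text{ for all }j\neq i\}$ and $\mathsf s_{[i|j]}f(x)=f(x\circ[i|j])$. $\mathfrak{Sg}\,X$ denotes the generated subalgebra (containing all $\bar r$). A *filter* of a subalgebra $\mathfrak S$ is a non-empty subset of $S$ that is closed under $\odot$ and upward closed in $S$; a *maximal*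 filter is a maximal proper one. A subset $F\subseteq S$ is *Henkin* if, for all $k\in\alpha$ and $x\in S$, $\mathsf c_kx\in F$ implies $\mathsf s_{[k|j]}x\in F$ for some $j\notin\Delta x$. For a subset $H$ put $[a]_H=\bigvee\{r\in L:\bar r\to a\in H\}\in[0,1]$. **Theorem.** Let $\mathfrak B$ be a dimension complemented $\mathsf{SA}_\alpha$. (1) Let $P$ be a Henkin maximal filter of $\mathfrak B$. Then $\psi:\mathfrak B\to\mathfrak F(V,[0,1])$, $\psi(p)(x)=[\mathsf s_xp]_P$, is a homomorphism: it preserves $\oplus,\odot,\neg,0,1$, all constants $\bar r$, all $\mathsf c_i$ and all $\mathsf s_{[i|j]}$. (2) Let $X_1,X_2\subseteq B$, $S_i=\mathfrak{Sg}\,X_i$, $S_0=\mathfrak{Sg}(X_1\cap X_2)$, $a\in S_1$, $b\in S_2$. Let $\langle(k_i,x_i):i<\alpha\rangle$ and $\langle(l_i,y_i):i<\alpha\rangle$ enumerate $\alpha\times S_1$ and $\alpha\times S_2$, and let $u_i,v_i\in\alpha$ $(i<\alpha)$ satisfy $$u_i\notin\Delta a\cup\Delta b\cup\bigcup_{j\le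 i}(\Delta x_j\cup\Delta y_j)\cup\{u_j:j<i\}\cup\{v_j:j<i\},$$ $$v_i\notin\Delta a\cup\Delta b\cup\bigcup_{j\le i}(\Delta x_j\cup\Delta y_j)\cup\{u_j:j\le i\}\cup\{v_j:j<i\}.$$ Let $H_1$ be the filter of $S_1$ generated by $\{a\}\cup\{\neg\mathsf c_{k_i}x_i\oplus\mathsf s_{[k_i|u_i]}x_i:i<\alpha\}$, $H_2$ the filter of $S_2$ generated by $\{\neg b\}\cup\{\neg\mathsf c_{l_i}y_i\oplus\mathsf s_{[l_i|v_i]}y_i:i<\alpha\}$, and $H$ the filter of $S_0$ generated by $(H_1\cap S_0)\cup(H_2\cap S_0)$. If $H\ne S_0$, then there are a maximal filter $H^*\supseteq H$ of $S_0$ and maximal filters $F_1\supseteq H_1\cup H^*$ of $S_1$ and $F_2\supseteq H_2\cup H^*$ of $S_2$. For all such $H^*,F_1,F_2$: both $F_1$ and $F_2$ are Henkin; the maps $\psi_i(p)(x)=[\mathsf s_xp]_{F_i}$ are homomorphisms from $S_i$ to $\mathfrak F(V,[0,1])$; and for every $c\in S_0$, $[c]_{F_1}=[c]_{F_2}$ and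 $\psi_1(c)=\psi_2(c)$. -/

import Mathlib

universe u v

/-! ### MV algebras -/

/-- The operations of an MV algebra. -/
class MVOps (A : Type v) where
  oplus : A → A → A
  odot : A → A → A
  neg : A → A
  zero : A
  one : A

infixl:65 " ⊕ₘ " => MVOps.oplus
infixl:70 " ⊙ₘ " => MVOps.odot
prefix:max "∼ₘ" => MVOps.neg

/-- MV algebras `(A, ⊕, ⊙, ¬, 0, 1)`. -/
class MVAlgebra (A : Type v) extends MVOps A where
  oplus_comm : ∀ a b : A, a ⊕ₘ b = b ⊕ₘ a
  odot_comm : ∀ a b : A, a ⊙ₘ b = b ⊙ₘ a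
  oplus_assoc : ∀ a b c : A, a ⊕ₘ (b ⊕ₘ c) = (a ⊕ₘ b) ⊕ₘ c
  odot_assoc : ∀ a b c : A, a ⊙ₘ (b ⊙ₘ c) = (a ⊙ₘ b) ⊙ₘ c
  oplus_zero : ∀ a : A, a ⊕ₘ zero = a
  odot_one : ∀ a : A, a ⊙ₘ one = a
  oplus_one : ∀ a : A, a ⊕ₘ one = one
  odot_zero : ∀ a : A, a ⊙ₘ zero = zero
  oplus_neg : ∀ a : A, a ⊕ₘ ∼ₘa = one
  odot_neg : ∀ a : A, a ⊙ₘ ∼ₘa = zero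
  neg_oplus : ∀ a b : A, ∼ₘ(a ⊕ₘ b) = ∼ₘa ⊙ₘ ∼ₘb
  neg_odot : ∀ a b : A, ∼ₘ(a ⊙ₘ b) = ∼ₘa ⊕ₘ ∼ₘb
  neg_neg : ∀ a : A, ∼ₘ(∼ₘa) = a
  neg_zero : ∼ₘ(zero : A) = one
  lukasiewicz : ∀ a b : A, ∼ₘ(∼ₘa ⊕ₘ b) ⊕ₘ b = ∼ₘ(∼ₘb ⊕ₘ a) ⊕ₘ a

/-- The lattice order of an MV algebra. -/
def mvLE {A : Type v} [MVOps A] (a b : A) : Prop := a ⊙ₘ ∼ₘb = MVOps.zero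

/-- The implication `a → b = ¬a ⊕ b`. -/
def mvImp {A : Type v} [MVOps A] (a b : A) : A := ∼ₘa ⊕ₘ b

section Standard

variable {K : Type v} [Field K] [LinearOrder K] [IsStrictOrderedRing K]

/-- The interval `[0,1]` of an ordered field, with `x ⊕ y = min (x + y) 1`,
`x ⊙ y = max (x + y - 1) 0` and `¬x = 1 - x`.  For `K = ℝ` this is the standard MV algebra, for
`K = ℚ` it is its subalgebra of rational truth values. -/
instance instMVOpsIcc : MVOps (Set.Icc (0 : K) 1) where
  oplus x y := ⟨min (x.1 + y.1) 1, le_min (add_nonneg x.2.1 y.2.1) zero_le_one, min_le_right _ _⟩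
  odot x y := ⟨max (x.1 + y.1 - 1) 0, le_max_right _ _,
    max_le (by linarith [x.2.2, y.2.2]) zero_le_one⟩
  neg x := ⟨1 - x.1, by linarith [x.2.2], by linarith [x.2.1]⟩
  zero := ⟨0, le_refl _, zero_le_one⟩
  one := ⟨1, zero_le_one, le_refl _⟩

instance instMVAlgebraIcc : MVAlgebra (Set.Icc (0 : K) 1) where
  oplus_comm := by
    rintro ⟨a, ha⟩ ⟨b, hb⟩
    simp only [MVOps.oplus, add_comm]
  odot_comm := by
    rintro ⟨a, ha⟩ ⟨b, hb⟩
    simp only [MVOps.odot, add_comm]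
  oplus_assoc := by
    rintro ⟨a, ha0, ha1⟩ ⟨b, hb0, hb1⟩ ⟨c, hc0, hc1⟩
    simp only [MVOps.oplus, Subtype.mk.injEq]
    grind
  odot_assoc := by
    rintro ⟨a, ha0, ha1⟩ ⟨b, hb0, hb1⟩ ⟨c, hc0, hc1⟩
    simp only [MVOps.odot, Subtype.mk.injEq]
    grind
  oplus_zero := by
    rintro ⟨a, ha0, ha1⟩
    apply Subtype.ext
    change min (a + 0) 1 = a
    grind
  odot_one := by
    rintro ⟨a, ha0, ha1⟩
    apply Subtype.ext
    change max (a + 1 - 1) 0 = a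
    grind
  oplus_one := by
    rintro ⟨a, ha0, ha1⟩
    apply Subtype.ext
    change min (a + 1) 1 = 1
    grind
  odot_zero := by
    rintro ⟨a, ha0, ha1⟩
    apply Subtype.ext
    change max (a + 0 - 1) 0 = 0
    grind
  oplus_neg := by
    rintro ⟨a, ha0, ha1⟩
    simp only [MVOps.oplus, MVOps.neg, MVOps.one]
    grind
  odot_neg := by
    rintro ⟨a, ha0, ha1⟩
    simp only [MVOps.odot, MVOps.neg, MVOps.zero]
    grind
  neg_oplus := by
    rintro ⟨a, ha0, ha1⟩ ⟨b, hb0, hb1⟩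
    simp only [MVOps.oplus, MVOps.odot, MVOps.neg, Subtype.mk.injEq]
    grind
  neg_odot := by
    rintro ⟨a, ha0, ha1⟩ ⟨b, hb0, hb1⟩
    simp only [MVOps.oplus, MVOps.odot, MVOps.neg, Subtype.mk.injEq]
    grind
  neg_neg := by
    rintro ⟨a, ha0, ha1⟩
    simp only [MVOps.neg]
    grind
  neg_zero := by
    apply Subtype.ext
    change (1 : K) - 0 = 1
    grind
  lukasiewicz := by
    rintro ⟨a, ha0, ha1⟩ ⟨b, hb0, hb1⟩
    simp only [MVOps.oplus, MVOps.neg, Subtype.mk.injEq]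
    grind

end Standard

/-! ### Pavelka algebras -/

/-- Truth constants `r̄`, one for every rational `r ∈ [0,1]`. -/
class TruthConst (A : Type v) where
  tc : Set.Icc (0 : ℚ) 1 → A

/-- A Pavelka algebra: an MV algebra with truth constants such that `0̄ = 0`, `r̄ ⊕ s̄` is the
constant of `r ⊕ s`, and `¬r̄` is the constant of `¬r`. -/
class PavelkaAlgebra (A : Type v) extends MVAlgebra A, TruthConst A where
  tc_zero : tc MVOps.zero = zero
  tc_oplus : ∀ r s : Set.Icc (0 : ℚ) 1, tc (r ⊕ₘ s) = tc r ⊕ₘ tc s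
  tc_neg : ∀ r : Set.Icc (0 : ℚ) 1, tc (∼ₘr) = ∼ₘ(tc r)

/-- Existential quantifiers on a Pavelka algebra. -/
structure IsQuantifier {A : Type v} [PavelkaAlgebra A] (e : A → A) : Prop where
  zero : e MVOps.zero = MVOps.zero
  le : ∀ a, mvLE a (e a)
  odot : ∀ a b, e (a ⊙ₘ e b) = e a ⊙ₘ e b
  oplus : ∀ a b, e (a ⊕ₘ e b) = e a ⊕ₘ e b
  odot_self : ∀ a, e (a ⊙ₘ a) = e a ⊙ₘ e a
  oplus_self : ∀ a, e (a ⊕ₘ a) = e a ⊕ₘ e a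
  tc : ∀ r, e (TruthConst.tc r) = TruthConst.tc r

/-- Endomorphisms of the MV reduct. -/
structure IsMVEndo {A : Type v} [MVOps A] (f : A → A) : Prop where
  zero : f MVOps.zero = MVOps.zero
  one : f MVOps.one = MVOps.one
  neg : ∀ a, f (∼ₘa) = ∼ₘ(f a)
  oplus : ∀ a b, f (a ⊕ₘ b) = f a ⊕ₘ f b
  odot : ∀ a b, f (a ⊙ₘ b) = f a ⊙ₘ f b

/-! ### MV substitution algebras -/

/-- Cylindrifications `c_i` and substitutions `s_{[i|j]}` (also written `s^i_j`); the latter is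
`sub i j`. -/
class SubstOps (I : Type u) (A : Type v) where
  cyl : I → A → A
  sub : I → I → A → A

open Classical in
/-- The replacement `[i|j]`: it maps `i` to `j` and fixes everything else. -/
noncomputable def replacement {I : Type u} (i j : I) : I → I := Function.update id i j

/-- The composite `[i₁|j₁] ∘ ⋯ ∘ [iₙ|jₙ]` of a finite sequence of replacements. -/
noncomputable def wordFun {I : Type u} : List (I × I) → I → I
  | [] => id
  | p :: w => replacement p.1 p.2 ∘ wordFun w

/-- The operation `s_{[i₁|j₁]} ⋯ s_{[iₙ|jₙ]}`. -/
def wordSub {I : Type u} {A : Type v} [SubstOps I A] : List (I × I) → A → A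
  | [], x => x
  | p :: w, x => SubstOps.sub p.1 p.2 (wordSub w x)

open Classical in
/-- MV substitution algebras of dimension `I` (with truth constants).  The operations indexed by
the semigroup generated by the replacements are the compositions `wordSub w`, so that an equation
about `s_τ`, with `τ` in this semigroup, is expressed by words `w` with `wordFun w = τ`.  The laws
for the dual quantifiers `q_i = ¬ c_i ¬` follow from those listed. -/
class SubstAlgebra (I : Type u) (A : Type v) [PavelkaAlgebra A] extends SubstOps I A where
  quantifier : ∀ i, IsQuantifier (cyl i)
  cyl_cyl : ∀ i x, cyl i (cyl i x) = cyl i x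
  cyl_neg_cyl : ∀ i x, cyl i (∼ₘ(cyl i x)) = ∼ₘ(cyl i x)
  cyl_comm : ∀ i j x, cyl i (cyl j x) = cyl j (cyl i x)
  endo : ∀ i j, IsMVEndo (sub i j)
  sub_word : ∀ w w' : List (I × I), wordFun w = wordFun w' →
    ∀ x : A, wordSub w x = wordSub w' x
  sub_cyl : ∀ (w w' : List (I × I)) (i j : I), wordFun w' = Function.update (wordFun w) i j →
    ∀ x : A, wordSub w (cyl i x) = wordSub w' (cyl i x)
  sub_cyl_comm : ∀ (w : List (I × I)) (i j : I), wordFun w ⁻¹' {j} = {i} →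
    ∀ x : A, wordSub w (cyl i x) = cyl j (wordSub w x)
  cyl_sub_self : ∀ i j x, i ≠ j → cyl i (sub i j x) = sub i j x
  sub_cyl_self : ∀ i j x, sub i j (cyl i x) = cyl i x
  sub_cyl_of_ne : ∀ i j k x, k ≠ i → k ≠ j → sub i j (cyl k x) = cyl k (sub i j x)
  cyl_sub_swap : ∀ i j x, cyl i (sub j i x) = cyl j (sub i j x)

/-- The dimension set `Δx = {i : c_i x ≠ x}`. -/
def dimSet (I : Type u) {A : Type v} [SubstOps I A] (x : A) : Set I :=
  {i | SubstOps.cyl i x ≠ x}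

/-- Dimension complemented algebras: the complement of every `Δx` is infinite. -/
def DimComplemented (I : Type u) (A : Type v) [SubstOps I A] : Prop :=
  ∀ x : A, (dimSet I x)ᶜ.Infinite

/-! ### Subalgebras, filters and truth values -/

section Subalgebras

variable (I : Type u) {A : Type v} [MVOps A] [TruthConst A] [SubstOps I A]

/-- Subuniverses; they contain the truth constants. -/
structure IsSubuniverse (S : Set A) : Prop where
  zero : MVOps.zero ∈ S
  one : MVOps.one ∈ S
  tc : ∀ r, TruthConst.tc r ∈ S
  neg : ∀ a ∈ S, ∼ₘa ∈ S
  oplus : ∀ a ∈ S, ∀ b ∈ S, a ⊕ₘ b ∈ S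
  odot : ∀ a ∈ S, ∀ b ∈ S, a ⊙ₘ b ∈ S
  cyl : ∀ (i : I), ∀ a ∈ S, SubstOps.cyl i a ∈ S
  sub : ∀ (i j : I), ∀ a ∈ S, SubstOps.sub i j a ∈ S

/-- `Sg X`, the (universe of the) subalgebra generated by `X`. -/
def Sg (X : Set A) : Set A := ⋂₀ {S | IsSubuniverse I S ∧ X ⊆ S}

end Subalgebras

section Filters

variable {A : Type v} [MVOps A]

/-- `F` is an MV filter of the subalgebra with universe `S`. -/
structure IsFilterOf (S F : Set A) : Prop where
  subset : F ⊆ S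
  nonempty : F.Nonempty
  odot : ∀ a ∈ F, ∀ b ∈ F, a ⊙ₘ b ∈ F
  upward : ∀ a ∈ F, ∀ b ∈ S, mvLE a b → b ∈ F

/-- `F` is a maximal (proper) MV filter of the subalgebra with universe `S`. -/
structure IsMaximalFilterOf (S F : Set A) : Prop where
  filter : IsFilterOf S F
  proper : F ≠ S
  maximal : ∀ G : Set A, IsFilterOf S G → F ⊆ G → G ≠ S → G = F

/-- The MV filter of the subalgebra with universe `S` that is generated by `Y`. -/
def filterGen (S Y : Set A) : Set A :=
  {z | z ∈ S ∧ ∃ l : List A, (∀ y ∈ l, y ∈ Y) ∧ mvLE (l.foldr MVOps.odot MVOps.one) z}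

/-- The Henkin property of a subset `F` of the subalgebra with universe `S`. -/
def IsHenkin (I : Type u) [SubstOps I A] (S F : Set A) : Prop :=
  ∀ k : I, ∀ x ∈ S, SubstOps.cyl k x ∈ F → ∃ j : I, j ∉ dimSet I x ∧ SubstOps.sub k j x ∈ F

/-- The truth value `[a]_H = ⋁ {r ∈ [0,1] ∩ ℚ : r̄ → a ∈ H}`, the supremum being taken in the
real interval `[0,1]`. -/
noncomputable def truthValue [TruthConst A] (H : Set A) (a : A) : Set.Icc (0 : ℝ) 1 :=
  ⟨sSup {t : ℝ | ∃ r : Set.Icc (0 : ℚ) 1, t = ((r : ℚ) : ℝ) ∧ mvImp (TruthConst.tc r) a ∈ H},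
    Real.sSup_nonneg (by
      rintro t ⟨r, rfl, -⟩
      exact_mod_cast r.2.1),
    Real.sSup_le (by
      rintro t ⟨r, rfl, -⟩
      exact_mod_cast r.2.2) zero_le_one⟩

end Filters

/-! ### Finite transformations and the operators `s_τ` -/

/-- The set `V` of finite transformations of `I`: those that move only finitely many points. -/
def FinTrans (I : Type u) : Type u := {x : I → I // {i | x i ≠ i}.Finite}

open Classical in
/-- The composite `x ∘ [i|j]`. -/
noncomputable def FinTrans.compReplacement {I : Type u} (x : FinTrans I) (i j : I) : FinTrans I :=
  ⟨x.1 ∘ replacement i j, (x.2.insert i).subset (by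
    intro k hk
    by_cases h : k = i
    · exact Set.mem_insert_iff.2 (Or.inl h)
    · refine Set.mem_insert_iff.2 (Or.inr ?_)
      simpa [replacement, Function.update_of_ne h] using hk)⟩

section Substitution

variable {I : Type u} [LinearOrder I] [WellFoundedLT I]

open Classical in
/-- The first `k` elements of a set `S`, in increasing order (if `S` has that many). -/
noncomputable def firstElements (S : Set I) : ℕ → List I
  | 0 => []
  | k + 1 =>
    if h : (S \ {i | i ∈ firstElements S k}).Nonempty then
      firstElements S k ++ [(wellFounded_lt (α := I)).min _ h]
    else firstElements S k

/-- The points moved by `x`, in increasing order: `u₀ < ⋯ < u_{k-1}`. -/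
noncomputable def FinTrans.moved (x : FinTrans I) : List I := x.2.toFinset.sort (· ≤ ·)

/-- The substitution `s_x p` for a finite transformation `x`.  If `u₀ < ⋯ < u_{k-1}` are the points
moved by `x`, `vᵢ = x uᵢ`, and `π₀, …, π_{k-1}` are the first `k` elements outside
`Δp ∪ {uᵢ} ∪ {vᵢ}`, then `s_x p` is
`s_{[π₀|v₀]} ⋯ s_{[π_{k-1}|v_{k-1}]} s_{[u₀|π₀]} ⋯ s_{[u_{k-1}|π_{k-1}]} p`. -/
noncomputable def substOp {A : Type v} [SubstOps I A] (x : FinTrans I) (p : A) : A :=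
  let U := x.moved
  let W := U.map x.1
  let π := firstElements (dimSet I p ∪ {i | i ∈ U} ∪ {i | i ∈ W})ᶜ U.length
  wordSub (π.zip W ++ U.zip π) p

end Substitution

/-! ### The set algebra `𝔉(V,[0,1])` -/

/-- The universe of `𝔉(V,[0,1])`: all functions from `V` to `[0,1]`. -/
def FunAlg (I : Type u) : Type u := FinTrans I → Set.Icc (0 : ℝ) 1

/-- The rational truth value `r`, as an element of the real interval `[0,1]`. -/
noncomputable def ratVal (r : Set.Icc (0 : ℚ) 1) : Set.Icc (0 : ℝ) 1 :=
  ⟨((r : ℚ) : ℝ), by exact_mod_cast r.2.1, by exact_mod_cast r.2.2⟩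

/-- The MV operations and the truth constants of `𝔉(V,[0,1])` are defined pointwise. -/
noncomputable instance instPavelkaFunAlg (I : Type u) : PavelkaAlgebra (FunAlg I) where
  oplus f g := fun x => f x ⊕ₘ g x
  odot f g := fun x => f x ⊙ₘ g x
  neg f := fun x => ∼ₘ(f x)
  zero := fun _ => MVOps.zero
  one := fun _ => MVOps.one
  tc r := fun _ => ratVal r
  oplus_comm _ _ := funext fun _ => MVAlgebra.oplus_comm _ _
  odot_comm _ _ := funext fun _ => MVAlgebra.odot_comm _ _
  oplus_assoc _ _ _ := funext fun _ => MVAlgebra.oplus_assoc _ _ _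
  odot_assoc _ _ _ := funext fun _ => MVAlgebra.odot_assoc _ _ _
  oplus_zero _ := funext fun _ => MVAlgebra.oplus_zero _
  odot_one _ := funext fun _ => MVAlgebra.odot_one _
  oplus_one _ := funext fun _ => MVAlgebra.oplus_one _
  odot_zero _ := funext fun _ => MVAlgebra.odot_zero _
  oplus_neg _ := funext fun _ => MVAlgebra.oplus_neg _
  odot_neg _ := funext fun _ => MVAlgebra.odot_neg _
  neg_oplus _ _ := funext fun _ => MVAlgebra.neg_oplus _ _
  neg_odot _ _ := funext fun _ => MVAlgebra.neg_odot _ _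
  neg_neg _ := funext fun _ => MVAlgebra.neg_neg _
  neg_zero := funext fun _ => MVAlgebra.neg_zero
  lukasiewicz _ _ := funext fun _ => MVAlgebra.lukasiewicz _ _
  tc_zero := funext fun _ => Subtype.ext (by simp [ratVal, MVOps.zero])
  tc_oplus r s := funext fun _ => Subtype.ext (by simp [ratVal, MVOps.oplus])
  tc_neg r := funext fun _ => Subtype.ext (by simp [ratVal, MVOps.neg])

/-- `c_i f (x) = ⋁ {f y : y ∈ V, y ≡ᵢ x}`, where `y ≡ᵢ x` means that `y` and `x` agree off `i`, and
`s_{[i|j]} f (x) = f (x ∘ [i|j])`. -/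
noncomputable instance instSubstOpsFunAlg (I : Type u) : SubstOps I (FunAlg I) where
  cyl i f := fun x =>
    ⟨sSup {t : ℝ | ∃ y : FinTrans I, (∀ j, j ≠ i → y.1 j = x.1 j) ∧ t = (f y : ℝ)},
      Real.sSup_nonneg (by
        rintro t ⟨y, -, rfl⟩
        exact (f y).2.1),
      Real.sSup_le (by
        rintro t ⟨y, -, rfl⟩
        exact (f y).2.2) zero_le_one⟩
  sub i j f := fun x => f (x.compReplacement i j)

/-- `f`, restricted to the subuniverse `S`, is a homomorphism: it preserves all operations of
substitution algebras with truth constants. -/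
structure IsHomOn (I : Type u) {A B : Type*} [MVOps A] [TruthConst A] [SubstOps I A]
    [MVOps B] [TruthConst B] [SubstOps I B] (S : Set A) (f : A → B) : Prop where
  zero : f MVOps.zero = MVOps.zero
  one : f MVOps.one = MVOps.one
  tc : ∀ r, f (TruthConst.tc r) = TruthConst.tc r
  neg : ∀ p ∈ S, f (∼ₘp) = ∼ₘ(f p)
  oplus : ∀ p ∈ S, ∀ q ∈ S, f (p ⊕ₘ q) = f p ⊕ₘ f q
  odot : ∀ p ∈ S, ∀ q ∈ S, f (p ⊙ₘ q) = f p ⊙ₘ f q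
  cyl : ∀ (i : I), ∀ p ∈ S, f (SubstOps.cyl i p) = SubstOps.cyl i (f p)
  sub : ∀ (i j : I), ∀ p ∈ S, f (SubstOps.sub i j p) = SubstOps.sub i j (f p)

/-- The map `ψ(p)(x) = [s_x p]_P`. -/
noncomputable def psi {I : Type u} [LinearOrder I] [WellFoundedLT I] {A : Type v} [MVOps A]
    [TruthConst A] [SubstOps I A] (P : Set A) (p : A) : FunAlg I :=
  fun x => truthValue P (substOp x p)

/-! ### The filters of the interpolation construction -/

section Construction

variable {I : Type u} [LinearOrder I] {A : Type v} [MVOps A] [TruthConst A] [SubstOps I A]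

/-- The sequence `⟨(kᵢ, xᵢ)⟩`, indexed by `I`, enumerates `I × S` (repetitions are allowed). -/
def Enumerates (S : Set A) (k : I → I) (x : I → A) : Prop :=
  (∀ i, x i ∈ S) ∧ ∀ j : I, ∀ z ∈ S, ∃ i, k i = j ∧ x i = z

/-- The two sequences of witnesses are chosen fresh. -/
def FreshWitnesses (a b : A) (x y : I → A) (w w' : I → I) : Prop :=
  (∀ i, w i ∉ dimSet I a ∪ dimSet I b ∪ (⋃ j ≤ i, (dimSet I (x j) ∪ dimSet I (y j))) ∪
      {m | ∃ j < i, w j = m} ∪ {m | ∃ j < i, w' j = m}) ∧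
  ∀ i, w' i ∉ dimSet I a ∪ dimSet I b ∪ (⋃ j ≤ i, (dimSet I (x j) ∪ dimSet I (y j))) ∪
      {m | ∃ j ≤ i, w j = m} ∪ {m | ∃ j < i, w' j = m}

/-- The set `{a} ∪ {¬c_{kᵢ} xᵢ ⊕ s_{[kᵢ|wᵢ]} xᵢ : i ∈ I}`. -/
def witnessSet (a : A) (k : I → I) (x : I → A) (w : I → I) : Set A :=
  {a} ∪ {z | ∃ i, z = ∼ₘ(SubstOps.cyl (k i) (x i)) ⊕ₘ SubstOps.sub (k i) (w i) (x i)}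

/-- The filter of `S₀` generated by `(H₁ ∩ S₀) ∪ (H₂ ∩ S₀)`. -/
def commonFilter (S₀ H₁ H₂ : Set A) : Set A := filterGen S₀ ((H₁ ∩ S₀) ∪ (H₂ ∩ S₀))

/-- `Hs` is a maximal filter of `S₀` extending the common filter of `H₁` and `H₂`, and `F₁`, `F₂`
are maximal filters of `S₁` and `S₂` extending `H₁ ∪ Hs` and `H₂ ∪ Hs`, respectively. -/
structure IsFilterTriple (S₀ S₁ S₂ H₁ H₂ Hs F₁ F₂ : Set A) : Prop where
  maximal₀ : IsMaximalFilterOf S₀ Hs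
  common_subset : commonFilter S₀ H₁ H₂ ⊆ Hs
  maximal₁ : IsMaximalFilterOf S₁ F₁
  subset₁ : H₁ ∪ Hs ⊆ F₁
  maximal₂ : IsMaximalFilterOf S₂ F₂
  subset₂ : H₂ ∪ Hs ⊆ F₂

end Construction

/-! ### Arithmetic of MV algebras: the order, implications, prelinearity and powers. -/

section MVBasics

variable {A : Type v} [MVAlgebra A]

/-! For a maximal filter `F` of a subalgebra, the truth value `[·]_F` is an MV homomorphism to
`[0,1]` fixing the constants: `F` is prime (`IsMaximalFilterOf.mvImp_total`) and contains no
constant below `1`, so every element is squeezed between rational constants modulo `F`.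

Composing it with `s_τ` for a word `τ` of replacements is harmless, since `s_τ` is an endomorphism.
The difficulty is that `V` is larger than the semigroup of words: a composite of replacements is the
identity or not injective. For a single `p`, a word agrees with `x` on `Δp`, because `Δp` is
co-infinite, and `s_x p` depends only on that restriction (`wordSub_congr`, `substOp_eq_wordSub`).
For two elements, `Δp ∪ Δq` may have no co-infinite superset of the form `Δz`, or even be
everything, so no common word need exist and `⊕` cannot be checked through one.

The way out is that linear relations do transfer. Collapse `x` on finite sets chosen separately off
each dimension set; every nontrivial collapse is a word, and inclusion-exclusion over the collapses
gives the relation at `x` (`sum_psi_eq_zero`). This yields `ψ(p) + ψ(q) = ψ(p ⊕ q) + ψ(p ⊙ q)`.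
Disjointness also transfers, by a doubling argument (`psi_eq_zero_of_disjoint`); applied to `p ⊙ q`
and `¬(p ⊕ q)` it turns additivity into preservation of truncated addition (`psi_oplus`).

For `c_i`, monotonicity gives one inequality. For the other, a word sending `i` alone to a fresh `j`
turns `s_x c_i p` into `c_j` of a substitution instance of `p`, and the Henkin property supplies a
witness (`exists_le_psi_of_tc_imp_mem`).

In part (2), the generators of `H₁` and `H₂` make `F₁` and `F₂` Henkin by modus ponens. Maximality
of `H^*` forces `F₁ ∩ S₀ = H^* = F₂ ∩ S₀`, so truth values agree on `S₀`, which is closed under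
every `s_x`. -/

instance MVAlgebra.odotCommutative : Std.Commutative (α := A) MVOps.odot :=
  ⟨MVAlgebra.odot_comm⟩

instance MVAlgebra.odotAssociative : Std.Associative (α := A) MVOps.odot :=
  ⟨fun a b c => (MVAlgebra.odot_assoc a b c).symm⟩

instance MVAlgebra.oplusCommutative : Std.Commutative (α := A) MVOps.oplus :=
  ⟨MVAlgebra.oplus_comm⟩

instance MVAlgebra.oplusAssociative : Std.Associative (α := A) MVOps.oplus :=
  ⟨fun a b c => (MVAlgebra.oplus_assoc a b c).symm⟩

theorem mv_zero_oplus (a : A) : MVOps.zero ⊕ₘ a = a := by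
  rw [MVAlgebra.oplus_comm, MVAlgebra.oplus_zero]

theorem mv_one_odot (a : A) : MVOps.one ⊙ₘ a = a := by
  rw [MVAlgebra.odot_comm, MVAlgebra.odot_one]

theorem mv_zero_odot (a : A) : MVOps.zero ⊙ₘ a = MVOps.zero := by
  rw [MVAlgebra.odot_comm, MVAlgebra.odot_zero]

theorem mv_neg_one : ∼ₘ(MVOps.one : A) = MVOps.zero := by
  rw [← MVAlgebra.neg_zero, MVAlgebra.neg_neg]

theorem mv_neg_oplus_self (a : A) : ∼ₘa ⊕ₘ a = MVOps.one := by
  rw [MVAlgebra.oplus_comm, MVAlgebra.oplus_neg]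

theorem mv_neg_injective {a b : A} (h : ∼ₘa = ∼ₘb) : a = b := by
  rw [← MVAlgebra.neg_neg a, h, MVAlgebra.neg_neg]

theorem mv_odot_eq (a b : A) : a ⊙ₘ b = ∼ₘ(∼ₘa ⊕ₘ ∼ₘb) := by
  rw [MVAlgebra.neg_oplus, MVAlgebra.neg_neg, MVAlgebra.neg_neg]

theorem mvImp_eq_one_iff {a b : A} : mvImp a b = MVOps.one ↔ mvLE a b := by
  unfold mvImp mvLE
  rw [mv_odot_eq, MVAlgebra.neg_neg]
  constructor
  · intro h; rw [h, mv_neg_one]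
  · intro h; apply mv_neg_injective; rw [h, mv_neg_one]

/-- The two expressions of the meet of two elements. -/
theorem mv_meet_comm (a b : A) : a ⊙ₘ (∼ₘa ⊕ₘ b) = b ⊙ₘ (∼ₘb ⊕ₘ a) := by
  -- The Łukasiewicz axiom at negated arguments is the De Morgan dual of the goal.
  have h := MVAlgebra.lukasiewicz (∼ₘa) (∼ₘb)
  apply mv_neg_injective
  simp only [MVAlgebra.neg_odot, MVAlgebra.neg_oplus, MVAlgebra.neg_neg] at h ⊢
  rw [MVAlgebra.oplus_comm, MVAlgebra.odot_comm, ← h, MVAlgebra.oplus_comm, MVAlgebra.odot_comm]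

theorem mvLE_refl (a : A) : mvLE a a := MVAlgebra.odot_neg a

theorem mvLE_oplus_right (a b : A) : mvLE a (b ⊕ₘ a) := by
  rw [← mvImp_eq_one_iff]
  unfold mvImp
  rw [show ∼ₘa ⊕ₘ (b ⊕ₘ a) = b ⊕ₘ (∼ₘa ⊕ₘ a) by ac_rfl, mv_neg_oplus_self,
    MVAlgebra.oplus_one]

/-- Composition of implications. -/
theorem mvImp_trans (a b c : A) : mvLE (mvImp a b ⊙ₘ mvImp b c) (mvImp a c) := by
  unfold mvLE mvImp
  rw [MVAlgebra.neg_oplus, MVAlgebra.neg_neg,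
    show (∼ₘa ⊕ₘ b) ⊙ₘ (∼ₘb ⊕ₘ c) ⊙ₘ (a ⊙ₘ ∼ₘc) = a ⊙ₘ (∼ₘa ⊕ₘ b) ⊙ₘ (∼ₘb ⊕ₘ c) ⊙ₘ ∼ₘc by ac_rfl,
    mv_meet_comm,
    show b ⊙ₘ (∼ₘb ⊕ₘ a) ⊙ₘ (∼ₘb ⊕ₘ c) ⊙ₘ ∼ₘc = b ⊙ₘ (∼ₘb ⊕ₘ c) ⊙ₘ (∼ₘb ⊕ₘ a) ⊙ₘ ∼ₘc by ac_rfl,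
    mv_meet_comm,
    show c ⊙ₘ (∼ₘc ⊕ₘ b) ⊙ₘ (∼ₘb ⊕ₘ a) ⊙ₘ ∼ₘc = (∼ₘc ⊕ₘ b) ⊙ₘ (∼ₘb ⊕ₘ a) ⊙ₘ (c ⊙ₘ ∼ₘc) by ac_rfl,
    MVAlgebra.odot_neg, MVAlgebra.odot_zero]

/-- Modus ponens. -/
theorem mv_odot_imp_le (a b : A) : mvLE (a ⊙ₘ mvImp a b) b := by
  unfold mvLE mvImp
  rw [mv_meet_comm, show b ⊙ₘ (∼ₘb ⊕ₘ a) ⊙ₘ ∼ₘb = (∼ₘb ⊕ₘ a) ⊙ₘ (b ⊙ₘ ∼ₘb) by ac_rfl,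
    MVAlgebra.odot_neg, MVAlgebra.odot_zero]

theorem mvLE_trans {a b c : A} (h : mvLE a b) (h' : mvLE b c) : mvLE a c := by
  have := mvImp_trans a b c
  rw [mvImp_eq_one_iff.2 h, mvImp_eq_one_iff.2 h', MVAlgebra.odot_one] at this
  unfold mvLE at this
  rw [mv_one_odot] at this
  rw [← mvImp_eq_one_iff]
  apply mv_neg_injective
  rw [this, mv_neg_one]

/-- Implications are preserved by adding an element on both sides. -/
theorem mvImp_oplus_right (a b c : A) : mvLE (mvImp a b) (mvImp (a ⊕ₘ c) (b ⊕ₘ c)) := by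
  rw [← mvImp_eq_one_iff]
  unfold mvImp
  have h1 := MVAlgebra.lukasiewicz a b
  have h2 := MVAlgebra.lukasiewicz (∼ₘa) c
  rw [MVAlgebra.neg_neg] at h2
  rw [show ∼ₘ(∼ₘa ⊕ₘ b) ⊕ₘ (∼ₘ(a ⊕ₘ c) ⊕ₘ (b ⊕ₘ c)) =
      (∼ₘ(∼ₘa ⊕ₘ b) ⊕ₘ b) ⊕ₘ (∼ₘ(a ⊕ₘ c) ⊕ₘ c) by ac_rfl, h1, h2,
    show ∀ s t : A, s ⊕ₘ a ⊕ₘ (t ⊕ₘ ∼ₘa) = s ⊕ₘ t ⊕ₘ (a ⊕ₘ ∼ₘa) by intro s t; ac_rfl,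
    MVAlgebra.oplus_neg, MVAlgebra.oplus_one]

theorem mvLE_antisymm {a b : A} (h : mvLE a b) (h' : mvLE b a) : a = b := by
  have := mv_meet_comm a b
  change a ⊙ₘ mvImp a b = b ⊙ₘ mvImp b a at this
  rwa [mvImp_eq_one_iff.2 h, mvImp_eq_one_iff.2 h', MVAlgebra.odot_one, MVAlgebra.odot_one] at this

theorem mvLE_odot_left (a b : A) : mvLE (a ⊙ₘ b) a := by
  unfold mvLE
  rw [show a ⊙ₘ b ⊙ₘ ∼ₘa = b ⊙ₘ (a ⊙ₘ ∼ₘa) by ac_rfl, MVAlgebra.odot_neg, MVAlgebra.odot_zero]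

theorem mvImp_neg (a b : A) : mvImp (∼ₘb) (∼ₘa) = mvImp a b := by
  unfold mvImp
  rw [MVAlgebra.neg_neg, MVAlgebra.oplus_comm]

/-- The differences `y ⊙ ¬x` and `x ⊙ ¬y` have meet zero; this is prelinearity in dual form. Three
swaps by `mv_meet_comm` bring a factor `y ⊙ ¬y` together. -/
theorem mv_sub_meet_sub (x y : A) :
    (y ⊙ₘ ∼ₘx) ⊙ₘ (∼ₘ(y ⊙ₘ ∼ₘx) ⊕ₘ (x ⊙ₘ ∼ₘy)) = MVOps.zero := by
  rw [MVAlgebra.neg_odot, MVAlgebra.neg_neg]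
  set g := x ⊙ₘ ∼ₘy with hg
  have h1 := mv_meet_comm (∼ₘx) (∼ₘy ⊕ₘ g)
  rw [MVAlgebra.neg_neg] at h1
  have h2 := mv_meet_comm y g
  have h3 := mv_meet_comm x (∼ₘ(∼ₘy ⊕ₘ g))
  rw [show y ⊙ₘ ∼ₘx ⊙ₘ (∼ₘy ⊕ₘ x ⊕ₘ g) = y ⊙ₘ (∼ₘx ⊙ₘ (x ⊕ₘ (∼ₘy ⊕ₘ g))) by ac_rfl, h1,
    show y ⊙ₘ ((∼ₘy ⊕ₘ g) ⊙ₘ (∼ₘ(∼ₘy ⊕ₘ g) ⊕ₘ ∼ₘx)) =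
      (y ⊙ₘ (∼ₘy ⊕ₘ g)) ⊙ₘ (∼ₘx ⊕ₘ ∼ₘ(∼ₘy ⊕ₘ g)) by ac_rfl, h2,
    show g ⊙ₘ (∼ₘg ⊕ₘ y) ⊙ₘ (∼ₘx ⊕ₘ ∼ₘ(∼ₘy ⊕ₘ g)) =
      (∼ₘg ⊕ₘ y) ⊙ₘ ∼ₘy ⊙ₘ (x ⊙ₘ (∼ₘx ⊕ₘ ∼ₘ(∼ₘy ⊕ₘ g))) by rw [hg]; ac_rfl, h3,
    MVAlgebra.neg_oplus ∼ₘy g, MVAlgebra.neg_neg]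
  rw [show ∀ s t : A, s ⊙ₘ ∼ₘy ⊙ₘ (y ⊙ₘ ∼ₘg ⊙ₘ t) = s ⊙ₘ ∼ₘg ⊙ₘ t ⊙ₘ (y ⊙ₘ ∼ₘy) by
    intro s t; ac_rfl, MVAlgebra.odot_neg, MVAlgebra.odot_zero]

/-- Prelinearity: `(b → a) → (a → b) = (a → b)`. -/
theorem mvImp_imp_swap (a b : A) : mvImp (mvImp b a) (mvImp a b) = mvImp a b := by
  have h := mv_sub_meet_sub b a
  have e : ∀ s t : A, s ⊙ₘ ∼ₘt = ∼ₘ(mvImp s t) := fun s t => by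
    unfold mvImp; rw [MVAlgebra.neg_oplus, MVAlgebra.neg_neg]
  rw [e a b, e b a, MVAlgebra.neg_neg] at h
  refine mvLE_antisymm ?_ (mvLE_oplus_right _ _)
  unfold mvLE
  rw [MVAlgebra.odot_comm, ← h]
  unfold mvImp
  congr 1
  ac_rfl

theorem mvLE_odot_iff {a b c : A} : mvLE (a ⊙ₘ b) c ↔ mvLE a (mvImp b c) := by
  unfold mvLE mvImp
  rw [MVAlgebra.neg_oplus, MVAlgebra.neg_neg, MVAlgebra.odot_assoc]

theorem mvLE_odot_mono_left {a b : A} (c : A) (h : mvLE a b) : mvLE (a ⊙ₘ c) (b ⊙ₘ c) :=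
  mvLE_odot_iff.2 (mvLE_trans h (mvLE_odot_iff.1 (mvLE_refl _)))

theorem mvLE_odot_mono {a b c d : A} (h : mvLE a b) (h' : mvLE c d) :
    mvLE (a ⊙ₘ c) (b ⊙ₘ d) := by
  refine mvLE_trans (mvLE_odot_mono_left c h) ?_
  rw [MVAlgebra.odot_comm b c, MVAlgebra.odot_comm b d]
  exact mvLE_odot_mono_left b h'

theorem mvLE_one (a : A) : mvLE a MVOps.one := by
  unfold mvLE; rw [mv_neg_one, MVAlgebra.odot_zero]

theorem zero_mvLE (a : A) : mvLE MVOps.zero a := mv_zero_odot _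

/-- The powers `1, a, a ⊙ a, …`. -/
def mvPow (a : A) : ℕ → A
  | 0 => MVOps.one
  | n + 1 => a ⊙ₘ mvPow a n

theorem mvPow_add (a : A) (m n : ℕ) : mvPow a (m + n) = mvPow a m ⊙ₘ mvPow a n := by
  induction m with
  | zero => rw [Nat.zero_add, mvPow, mv_one_odot]
  | succ m ih => rw [Nat.add_right_comm, mvPow, mvPow, ih, MVAlgebra.odot_assoc]

/-- If `a → b = b`, then `aⁿ → b = b`. -/
theorem mvImp_mvPow {a b : A} (h : mvImp a b = b) (n : ℕ) : mvImp (mvPow a n) b = b := by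
  induction n with
  | zero => rw [mvPow, mvImp, mv_neg_one, mv_zero_oplus]
  | succ n ih =>
    unfold mvImp at *
    rw [mvPow, MVAlgebra.neg_odot, ← MVAlgebra.oplus_assoc, ih, h]

theorem mvLE_foldr_append (l l' : List A) :
    mvLE ((l ++ l').foldr MVOps.odot MVOps.one)
      (l.foldr MVOps.odot MVOps.one ⊙ₘ l'.foldr MVOps.odot MVOps.one) := by
  induction l with
  | nil => rw [List.nil_append, List.foldr_nil, mv_one_odot]; exact mvLE_refl _
  | cons a l ih =>
    rw [List.cons_append, List.foldr_cons, List.foldr_cons, ← MVAlgebra.odot_assoc]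
    exact mvLE_odot_mono (mvLE_refl a) ih

end MVBasics

/-! ### Filters of subalgebras and primeness of maximal filters. -/

section FilterTheory

variable {I : Type u} {A : Type v} [PavelkaAlgebra A] [SubstOps I A] {S F : Set A}

theorem IsSubuniverse.imp (hS : IsSubuniverse I S) {a b : A} (ha : a ∈ S) (hb : b ∈ S) :
    mvImp a b ∈ S := hS.oplus _ (hS.neg _ ha) _ hb

theorem IsSubuniverse.pow (hS : IsSubuniverse I S) {a : A} (ha : a ∈ S) (n : ℕ) :
    mvPow a n ∈ S := by
  induction n with
  | zero => exact hS.one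
  | succ n ih => exact hS.odot _ ha _ ih

theorem isSubuniverse_univ : IsSubuniverse I (Set.univ : Set A) := by
  constructor <;> intros <;> trivial

theorem isSubuniverse_Sg (X : Set A) : IsSubuniverse I (Sg I X) where
  zero := fun _ h => h.1.zero
  one := fun _ h => h.1.one
  tc r := fun _ h => h.1.tc r
  neg a ha := fun T h => h.1.neg a (ha T h)
  oplus a ha b hb := fun T h => h.1.oplus a (ha T h) b (hb T h)
  odot a ha b hb := fun T h => h.1.odot a (ha T h) b (hb T h)
  cyl i a ha := fun T h => h.1.cyl i a (ha T h)
  sub i j a ha := fun T h => h.1.sub i j a (ha T h)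

theorem Sg_mono {X Y : Set A} (h : X ⊆ Y) : Sg I X ⊆ Sg I Y :=
  fun _ ha T hT => ha T ⟨hT.1, h.trans hT.2⟩

theorem IsFilterOf.one_mem (hF : IsFilterOf S F) (hS : IsSubuniverse I S) : MVOps.one ∈ F := by
  obtain ⟨a, ha⟩ := hF.nonempty
  exact hF.upward a ha _ hS.one (mvLE_one a)

theorem IsFilterOf.eq_of_zero_mem (hF : IsFilterOf S F) (h : MVOps.zero ∈ F) : F = S :=
  hF.subset.antisymm fun b hb => hF.upward _ h b hb (zero_mvLE b)

theorem IsFilterOf.mp (hF : IsFilterOf S F) {a b : A} (ha : a ∈ F) (hab : mvImp a b ∈ F)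
    (hb : b ∈ S) : b ∈ F :=
  hF.upward _ (hF.odot _ ha _ hab) b hb (mv_odot_imp_le a b)

theorem IsFilterOf.mvImp_trans (hF : IsFilterOf S F) (hS : IsSubuniverse I S) {a b c : A}
    (ha : a ∈ S) (hc : c ∈ S) (h : mvImp a b ∈ F) (h' : mvImp b c ∈ F) : mvImp a c ∈ F :=
  hF.upward _ (hF.odot _ h _ h') _ (hS.imp ha hc) (_root_.mvImp_trans a b c)

theorem IsFilterOf.mvImp_of_le (hF : IsFilterOf S F) (hS : IsSubuniverse I S) {a b : A}
    (h : mvLE a b) : mvImp a b ∈ F := by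
  rw [mvImp_eq_one_iff.2 h]
  exact hF.one_mem hS

/-- The filter of `S` generated by two multiplicative sets. -/
def filterJoin (S F G : Set A) : Set A := {z | z ∈ S ∧ ∃ f ∈ F, ∃ g ∈ G, mvLE (f ⊙ₘ g) z}

theorem isFilterOf_filterJoin (hS : IsSubuniverse I S) {G : Set A}
    (hF : ∀ a ∈ F, ∀ b ∈ F, a ⊙ₘ b ∈ F) (hG : ∀ a ∈ G, ∀ b ∈ G, a ⊙ₘ b ∈ G)
    (hF1 : MVOps.one ∈ F) (hG1 : MVOps.one ∈ G) : IsFilterOf S (filterJoin S F G) where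
  subset := fun _ h => h.1
  nonempty := ⟨MVOps.one, hS.one, _, hF1, _, hG1, mvLE_one _⟩
  odot := by
    rintro a ⟨ha, f, hf, g, hg, h⟩ b ⟨hb, f', hf', g', hg', h'⟩
    refine ⟨hS.odot _ ha _ hb, _, hF _ hf _ hf', _, hG _ hg _ hg', ?_⟩
    rw [show f ⊙ₘ f' ⊙ₘ (g ⊙ₘ g') = f ⊙ₘ g ⊙ₘ (f' ⊙ₘ g') by ac_rfl]
    exact mvLE_odot_mono h h'
  upward := by
    rintro a ⟨-, f, hf, g, hg, h⟩ b hb hab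
    exact ⟨hb, f, hf, g, hg, mvLE_trans h hab⟩

theorem subset_filterJoin_left {G : Set A} (hF : F ⊆ S) (hG1 : MVOps.one ∈ G) :
    F ⊆ filterJoin S F G :=
  fun a ha => ⟨hF ha, a, ha, _, hG1, mvLE_odot_left _ _⟩

theorem subset_filterJoin_right {G : Set A} (hG : G ⊆ S) (hF1 : MVOps.one ∈ F) :
    G ⊆ filterJoin S F G :=
  fun a ha => ⟨hG ha, _, hF1, a, ha, by rw [mv_one_odot]; exact mvLE_refl a⟩

theorem isFilterOf_filterGen (hS : IsSubuniverse I S) (Y : Set A) :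
    IsFilterOf S (filterGen S Y) where
  subset := fun _ h => h.1
  nonempty := ⟨MVOps.one, hS.one, [], by simp, mvLE_one _⟩
  odot := by
    rintro a ⟨ha, l, hl, h⟩ b ⟨hb, l', hl', h'⟩
    refine ⟨hS.odot _ ha _ hb, l ++ l', ?_, mvLE_trans (mvLE_foldr_append l l')
      (mvLE_odot_mono h h')⟩
    intro y hy
    exact (List.mem_append.1 hy).elim (hl y) (hl' y)
  upward := by
    rintro a ⟨-, l, hl, h⟩ b hb hab
    exact ⟨hb, l, hl, mvLE_trans h hab⟩

theorem mem_filterGen {Y : Set A} {y : A} (hy : y ∈ Y) (hS : y ∈ S) : y ∈ filterGen S Y :=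
  ⟨hS, [y], by simpa using hy, by
    rw [List.foldr_cons, List.foldr_nil, MVAlgebra.odot_one]; exact mvLE_refl y⟩

/-- An element outside a maximal filter has a power whose negation is in the filter. -/
theorem IsMaximalFilterOf.exists_neg_pow_mem (hF : IsMaximalFilterOf S F)
    (hS : IsSubuniverse I S) {a : A} (ha : a ∈ S) (haF : a ∉ F) :
    ∃ n, ∼ₘ(mvPow a n) ∈ F := by
  by_contra! hn
  have h1 := hF.filter.one_mem hS
  have hG := isFilterOf_filterJoin (G := Set.range (mvPow a)) hS hF.filter.odot (by
    rintro _ ⟨m, rfl⟩ _ ⟨n, rfl⟩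
    exact ⟨m + n, mvPow_add a m n⟩) h1 ⟨0, rfl⟩
  have hsub := subset_filterJoin_left (G := Set.range (mvPow a)) hF.filter.subset ⟨0, rfl⟩
  -- If `f ⊙ aⁿ ≤ 0` with `f ∈ F`, then `f ≤ ¬aⁿ` by residuation, against the assumption.
  have hne : filterJoin S F (Set.range (mvPow a)) ≠ S := by
    intro h
    have h0 := hS.zero
    rw [← h] at h0
    obtain ⟨-, f, hf, _, ⟨n, rfl⟩, h0⟩ := h0
    refine hn n (hF.filter.upward f hf _ (hS.neg _ (hS.pow ha n)) ?_)
    have := mvLE_odot_iff.1 h0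
    rwa [mvImp, MVAlgebra.oplus_zero] at this
  refine haF ?_
  rw [← hF.maximal _ hG hsub hne]
  exact subset_filterJoin_right (G := Set.range (mvPow a)) (fun z hz => by
    obtain ⟨n, rfl⟩ := hz; exact hS.pow ha n) h1 ⟨1, by simp [mvPow, MVAlgebra.odot_one]⟩

theorem IsMaximalFilterOf.zero_notMem (hF : IsMaximalFilterOf S F) : MVOps.zero ∉ F :=
  fun h => hF.proper (hF.filter.eq_of_zero_mem h)

/-- Maximal filters are prime. -/
theorem IsMaximalFilterOf.mvImp_total (hF : IsMaximalFilterOf S F) (hS : IsSubuniverse I S)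
    {a b : A} (ha : a ∈ S) (hb : b ∈ S) : mvImp a b ∈ F ∨ mvImp b a ∈ F := by
  by_contra! h
  obtain ⟨n, hn⟩ := hF.exists_neg_pow_mem hS (hS.imp hb ha) h.2
  refine h.1 (hF.filter.upward _ hn _ (hS.imp ha hb) ?_)
  -- With `c = b → a`, this says `¬cⁿ ≤ (cⁿ → (a → b))`; prelinearity, iterated `n` times, reduces
  -- the right side to `a → b`.
  have h2 := mvLE_oplus_right (∼ₘ(mvPow (mvImp b a) n)) (mvImp a b)
  rw [MVAlgebra.oplus_comm] at h2
  change mvLE _ (mvImp _ _) at h2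
  rwa [mvImp_mvPow (mvImp_imp_swap a b) n] at h2

/-! ### Truth constants in a maximal filter and the truth value as a homomorphism. -/

theorem tc_one : TruthConst.tc MVOps.one = (MVOps.one : A) := by
  rw [← MVAlgebra.neg_zero (A := Set.Icc (0 : ℚ) 1), PavelkaAlgebra.tc_neg,
    PavelkaAlgebra.tc_zero, MVAlgebra.neg_zero]

theorem tc_odot (r s : Set.Icc (0 : ℚ) 1) :
    TruthConst.tc (r ⊙ₘ s) = (TruthConst.tc r ⊙ₘ TruthConst.tc s : A) := by
  rw [mv_odot_eq, PavelkaAlgebra.tc_neg, PavelkaAlgebra.tc_oplus, PavelkaAlgebra.tc_neg,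
    PavelkaAlgebra.tc_neg, ← mv_odot_eq]

theorem tc_imp (r s : Set.Icc (0 : ℚ) 1) :
    mvImp (TruthConst.tc r) (TruthConst.tc s) = (TruthConst.tc (mvImp r s) : A) := by
  rw [mvImp, mvImp, PavelkaAlgebra.tc_oplus, PavelkaAlgebra.tc_neg]

/-- A proper filter contains no truth constant other than `1`. -/
theorem IsMaximalFilterOf.eq_one_of_tc_mem (hF : IsMaximalFilterOf S F)
    (hS : IsSubuniverse I S) {r : Set.Icc (0 : ℚ) 1} (h : TruthConst.tc r ∈ F) :
    (r : ℚ) = 1 := by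
  by_contra hr
  have hr1 : (r : ℚ) < 1 := lt_of_le_of_ne r.2.2 hr
  -- The `n`-fold `⊙`-power of `r` is `max (1 - n (1 - r)) 0`, which reaches `0` when `r < 1`.
  have key : ∀ n : ℕ, ∃ s : Set.Icc (0 : ℚ) 1, TruthConst.tc s ∈ F ∧
      (s : ℚ) ≤ max (1 - (n : ℚ) * (1 - (r : ℚ))) 0 := by
    intro n
    induction n with
    | zero => exact ⟨MVOps.one, by rw [tc_one]; exact hF.filter.one_mem hS, by
        change (1 : ℚ) ≤ _; norm_num⟩
    | succ n ih =>
      obtain ⟨s, hs, hle⟩ := ih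
      refine ⟨r ⊙ₘ s, by rw [tc_odot]; exact hF.filter.odot _ h _ hs, ?_⟩
      change max ((r : ℚ) + s - 1) 0 ≤ _
      push_cast
      rcases le_max_iff.1 hle with h1 | h1
      · exact max_le_max (by linarith) le_rfl
      · have : (r : ℚ) + s - 1 ≤ 0 := by linarith
        exact max_le (this.trans (le_max_right _ _)) (le_max_right _ _)
  obtain ⟨n, hn⟩ := exists_nat_gt (1 / (1 - (r : ℚ)))
  obtain ⟨s, hs, hle⟩ := key n
  have : 1 < n * (1 - (r : ℚ)) := by rwa [div_lt_iff₀ (by linarith)] at hn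
  rw [max_eq_right (by linarith)] at hle
  have hs0 : s = MVOps.zero := Subtype.ext (le_antisymm hle s.2.1)
  rw [hs0, PavelkaAlgebra.tc_zero] at hs
  exact hF.zero_notMem hs

theorem IsMaximalFilterOf.tc_imp_mem_iff (hF : IsMaximalFilterOf S F)
    (hS : IsSubuniverse I S) {r s : Set.Icc (0 : ℚ) 1} :
    mvImp (TruthConst.tc r) (TruthConst.tc s) ∈ F ↔ (r : ℚ) ≤ s := by
  have e : ((mvImp r s : Set.Icc (0 : ℚ) 1) : ℚ) = min (1 - (r : ℚ) + s) 1 := rfl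
  rw [tc_imp]
  constructor
  · intro h
    have := hF.eq_one_of_tc_mem hS h
    rw [e, min_eq_right_iff] at this
    linarith
  · intro h
    have : mvImp r s = MVOps.one := Subtype.ext (by rw [e, min_eq_right (by linarith)]; rfl)
    rw [this, tc_one]
    exact hF.filter.one_mem hS

theorem le_truthValue {a : A} {r : Set.Icc (0 : ℚ) 1} (h : mvImp (TruthConst.tc r) a ∈ F) :
    ((r : ℚ) : ℝ) ≤ truthValue F a :=
  le_csSup ⟨1, by rintro t ⟨r, rfl, -⟩; exact_mod_cast r.2.2⟩ ⟨r, rfl, h⟩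

theorem IsMaximalFilterOf.truthValue_le (hF : IsMaximalFilterOf S F) (hS : IsSubuniverse I S)
    {a : A} {r : Set.Icc (0 : ℚ) 1} (h : mvImp a (TruthConst.tc r) ∈ F) :
    (truthValue F a : ℝ) ≤ (r : ℚ) := by
  refine Real.sSup_le ?_ (by exact_mod_cast r.2.1)
  rintro t ⟨s, rfl, hs⟩
  exact_mod_cast (hF.tc_imp_mem_iff hS).1
    (hF.filter.mvImp_trans hS (hS.tc s) (hS.tc r) hs h)

theorem IsMaximalFilterOf.tc_imp_mem_of_lt (hF : IsMaximalFilterOf S F)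
    (hS : IsSubuniverse I S) {a : A} (ha : a ∈ S) {r : Set.Icc (0 : ℚ) 1}
    (h : ((r : ℚ) : ℝ) < truthValue F a) : mvImp (TruthConst.tc r) a ∈ F :=
  (hF.mvImp_total hS (hS.tc r) ha).resolve_right fun h' =>
    absurd (hF.truthValue_le hS h') (not_le.2 h)

theorem IsMaximalFilterOf.imp_tc_mem_of_lt (hF : IsMaximalFilterOf S F)
    (hS : IsSubuniverse I S) {a : A} (ha : a ∈ S) {r : Set.Icc (0 : ℚ) 1}
    (h : (truthValue F a : ℝ) < (r : ℚ)) : mvImp a (TruthConst.tc r) ∈ F :=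
  (hF.mvImp_total hS ha (hS.tc r)).resolve_right fun h' =>
    absurd (le_truthValue h') (not_le.2 h)

/-- Rational approximations of truth values. -/
theorem IsMaximalFilterOf.exists_approx (hF : IsMaximalFilterOf S F) (hS : IsSubuniverse I S)
    {a : A} (ha : a ∈ S) {ε : ℝ} (hε : 0 < ε) : ∃ r s : Set.Icc (0 : ℚ) 1,
      mvImp (TruthConst.tc r) a ∈ F ∧ mvImp a (TruthConst.tc s) ∈ F ∧
      ((s : ℚ) : ℝ) < (r : ℚ) + ε := by
  have h0 := (truthValue F a).2.1
  have h1 := (truthValue F a).2.2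
  have hl : ∃ r : Set.Icc (0 : ℚ) 1, mvImp (TruthConst.tc r) a ∈ F ∧
      (truthValue F a : ℝ) < (r : ℚ) + ε / 2 := by
    obtain ⟨q, hq, hq'⟩ := exists_rat_btwn
      (show (truthValue F a : ℝ) - ε / 2 < truthValue F a by linarith)
    -- The rational approximation may fall below `0`; the constant `0` then serves as lower bound.
    -- Dually, `1` replaces an upper approximation beyond `1`.
    by_cases h : 0 ≤ q
    · refine ⟨⟨q, h, ?_⟩, hF.tc_imp_mem_of_lt hS ha hq', by simp only; linarith⟩
      exact_mod_cast (hq'.trans_le h1).le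
    · refine ⟨MVOps.zero, ?_, ?_⟩
      · rw [PavelkaAlgebra.tc_zero]
        exact hF.filter.mvImp_of_le hS (zero_mvLE a)
      · have : (q : ℝ) < 0 := by exact_mod_cast not_le.1 h
        change (truthValue F a : ℝ) < ((0 : ℚ) : ℝ) + ε / 2
        push_cast
        linarith
  have hu : ∃ r : Set.Icc (0 : ℚ) 1, mvImp a (TruthConst.tc r) ∈ F ∧
      ((r : ℚ) : ℝ) < truthValue F a + ε / 2 := by
    obtain ⟨q, hq, hq'⟩ := exists_rat_btwn
      (show (truthValue F a : ℝ) < truthValue F a + ε / 2 by linarith)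
    by_cases h : q ≤ 1
    · refine ⟨⟨q, ?_, h⟩, hF.imp_tc_mem_of_lt hS ha hq, hq'⟩
      exact_mod_cast (h0.trans_lt hq).le
    · refine ⟨MVOps.one, ?_, ?_⟩
      · rw [tc_one]
        exact hF.filter.mvImp_of_le hS (mvLE_one a)
      · have : (1 : ℝ) < q := by exact_mod_cast not_le.1 h
        change ((1 : ℚ) : ℝ) < truthValue F a + ε / 2
        push_cast
        linarith
  obtain ⟨r, hr, hr'⟩ := hl
  obtain ⟨s, hs, hs'⟩ := hu
  exact ⟨r, s, hr, hs, by linarith⟩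

theorem IsMaximalFilterOf.truthValue_tc (hF : IsMaximalFilterOf S F) (hS : IsSubuniverse I S)
    (r : Set.Icc (0 : ℚ) 1) : truthValue F (TruthConst.tc r : A) = ratVal r :=
  Subtype.ext (le_antisymm (hF.truthValue_le hS (hF.filter.mvImp_of_le hS (mvLE_refl _)))
    (le_truthValue (hF.filter.mvImp_of_le hS (mvLE_refl _))))

theorem IsMaximalFilterOf.truthValue_neg (hF : IsMaximalFilterOf S F)
    (hS : IsSubuniverse I S) {a : A} (ha : a ∈ S) :
    truthValue F (∼ₘa) = ∼ₘ(truthValue F a) := by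
  refine Subtype.ext (eq_of_forall_dist_le fun ε hε => ?_)
  obtain ⟨r, s, hr, hs, hrs⟩ := hF.exists_approx hS ha hε
  have h1 := le_truthValue hr
  have h2 := hF.truthValue_le hS hs
  rw [← mvImp_neg, ← PavelkaAlgebra.tc_neg] at hr hs
  have h3 := hF.truthValue_le hS hr
  have h4 := le_truthValue hs
  change ((1 - (s : ℚ) : ℚ) : ℝ) ≤ _ at h4
  change _ ≤ ((1 - (r : ℚ) : ℚ) : ℝ) at h3
  push_cast at h3 h4
  change |(truthValue F (∼ₘa) : ℝ) - (1 - truthValue F a)| ≤ ε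
  rw [abs_le]
  constructor <;> linarith

theorem IsFilterOf.mvImp_oplus (hF : IsFilterOf S F) (hS : IsSubuniverse I S) {a b c d : A}
    (ha : a ∈ S) (hb : b ∈ S) (hc : c ∈ S) (hd : d ∈ S) (h : mvImp a b ∈ F)
    (h' : mvImp c d ∈ F) : mvImp (a ⊕ₘ c) (b ⊕ₘ d) ∈ F := by
  have h1 := hF.upward _ h _ (hS.imp (hS.oplus _ ha _ hc) (hS.oplus _ hb _ hc))
    (mvImp_oplus_right a b c)
  have h2 := hF.upward _ h' _ (hS.imp (hS.oplus _ hc _ hb) (hS.oplus _ hd _ hb))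
    (mvImp_oplus_right c d b)
  rw [MVAlgebra.oplus_comm c b, MVAlgebra.oplus_comm d b] at h2
  exact hF.mvImp_trans hS (hS.oplus _ ha _ hc) (hS.oplus _ hb _ hd) h1 h2

/-- Implications modulo `F` may be added, so constants bracketing `a` and `b` within `ε / 2` give
constants bracketing `a ⊕ b` within `ε`. -/
theorem IsMaximalFilterOf.truthValue_oplus (hF : IsMaximalFilterOf S F)
    (hS : IsSubuniverse I S) {a b : A} (ha : a ∈ S) (hb : b ∈ S) :
    truthValue F (a ⊕ₘ b) = truthValue F a ⊕ₘ truthValue F b := by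
  refine Subtype.ext (eq_of_forall_dist_le fun ε hε => ?_)
  obtain ⟨r, s, hr, hs, hrs⟩ := hF.exists_approx hS ha (half_pos hε)
  obtain ⟨r', s', hr', hs', hrs'⟩ := hF.exists_approx hS hb (half_pos hε)
  have h1 := le_truthValue hr
  have h2 := hF.truthValue_le hS hs
  have h1' := le_truthValue hr'
  have h2' := hF.truthValue_le hS hs'
  have h3 := hF.filter.mvImp_oplus hS (hS.tc r) ha (hS.tc r') hb hr hr'
  have h4 := hF.filter.mvImp_oplus hS ha (hS.tc s) hb (hS.tc s') hs hs'
  rw [← PavelkaAlgebra.tc_oplus] at h3 h4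
  replace h3 := le_truthValue h3
  replace h4 := hF.truthValue_le hS h4
  change ((min ((r : ℚ) + r') 1 : ℚ) : ℝ) ≤ _ at h3
  change _ ≤ ((min ((s : ℚ) + s') 1 : ℚ) : ℝ) at h4
  push_cast at h3 h4
  change |(truthValue F (a ⊕ₘ b) : ℝ) - min ((truthValue F a : ℝ) + truthValue F b) 1| ≤ ε
  rw [abs_le]
  constructor <;> grind

theorem IsMaximalFilterOf.truthValue_odot (hF : IsMaximalFilterOf S F)
    (hS : IsSubuniverse I S) {a b : A} (ha : a ∈ S) (hb : b ∈ S) :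
    truthValue F (a ⊙ₘ b) = truthValue F a ⊙ₘ truthValue F b := by
  rw [mv_odot_eq, hF.truthValue_neg hS (hS.oplus _ (hS.neg _ ha) _ (hS.neg _ hb)),
    hF.truthValue_oplus hS (hS.neg _ ha) (hS.neg _ hb), hF.truthValue_neg hS ha,
    hF.truthValue_neg hS hb, ← mv_odot_eq]

end FilterTheory

/-! ### Words of replacements and their action on single elements. -/

section Words

variable {I : Type u} {A : Type v}

theorem replacement_self (i j : I) : replacement i j i = j := by
  simp [replacement]

theorem replacement_of_ne {i k : I} (j : I) (h : k ≠ i) : replacement i j k = k := by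
  simp [replacement, h]

theorem wordFun_append (w w' : List (I × I)) : wordFun (w ++ w') = wordFun w ∘ wordFun w' := by
  induction w with
  | nil => rfl
  | cons p w ih => rw [List.cons_append, wordFun, wordFun, ih]; rfl

theorem wordSub_append [SubstOps I A] (w w' : List (I × I)) (x : A) :
    wordSub (w ++ w') x = wordSub w (wordSub w' x) := by
  induction w with
  | nil => rfl
  | cons p w ih => rw [List.cons_append, wordSub, wordSub, ih]

theorem finite_wordFun_ne (w : List (I × I)) : {z | wordFun w z ≠ z}.Finite := by
  induction w with
  | nil => simp [wordFun]
  | cons p w ih =>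
    refine (ih.insert p.1).subset fun z hz => ?_
    by_contra h
    simp only [Set.mem_insert_iff, Set.mem_ofPred_eq, not_or, not_not] at h
    apply hz
    rw [wordFun, Function.comp_apply, h.2, replacement_of_ne _ h.1]

/-- Since `m ∉ T`, no later replacement moves a point that has already been sent to `m`. -/
theorem wordFun_map_collapse (T : List I) {m : I} (hm : m ∉ T) (z : I) :
    (z ∈ T → wordFun (T.map (·, m)) z = m) ∧ (z ∉ T → wordFun (T.map (·, m)) z = z) := by
  induction T with
  | nil => simp [wordFun]
  | cons t T ih =>
    rw [List.mem_cons, not_or] at hm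
    obtain ⟨h1, h2⟩ := ih hm.2
    rw [List.map_cons, wordFun, Function.comp_apply]
    constructor
    · intro h
      by_cases hz : z ∈ T
      · rw [h1 hz, replacement_of_ne _ hm.1]
      · rw [h2 hz, (List.mem_cons.1 h).resolve_right hz, replacement_self]
    · intro h
      rw [List.mem_cons, not_or] at h
      rw [h2 h.2, replacement_of_ne _ h.1]

theorem wordFun_zip_of_notMem (U V : List I) {z : I} (hz : z ∉ U) :
    wordFun (U.zip V) z = z := by
  induction U generalizing V with
  | nil => rfl
  | cons a U ih =>
    rw [List.mem_cons, not_or] at hz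
    cases V with
    | nil => rfl
    | cons b V =>
      rw [List.zip_cons_cons, wordFun, Function.comp_apply, ih V hz.2, replacement_of_ne _ hz.1]

theorem wordFun_zip_getElem (U V : List I) (hU : U.Nodup) (hV : ∀ v ∈ V, v ∉ U) (n : ℕ)
    (h : n < U.length) (h' : n < V.length) : wordFun (U.zip V) U[n] = V[n] := by
  induction U generalizing V n with
  | nil => simp at h
  | cons a U ih =>
    cases V with
    | nil => simp at h'
    | cons b V =>
      rw [List.nodup_cons] at hU
      rw [List.zip_cons_cons, wordFun, Function.comp_apply]
      cases n with
      | zero =>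
        rw [List.getElem_cons_zero, List.getElem_cons_zero, wordFun_zip_of_notMem U V hU.1,
          replacement_self]
      | succ n =>
        rw [List.getElem_cons_succ, List.getElem_cons_succ,
          ih V hU.2 (fun v hv hvU => hV v (List.mem_cons_of_mem _ hv) (List.mem_cons_of_mem _ hvU))]
        refine replacement_of_ne _ fun e => ?_
        exact hV _ (List.mem_cons_of_mem _ (List.getElem_mem (by simpa using h')))
          (by rw [e]; exact List.mem_cons_self)

theorem wordSub_mem [MVOps A] [TruthConst A] [SubstOps I A] {S : Set A} (hS : IsSubuniverse I S)
    (w : List (I × I)) {p : A} (hp : p ∈ S) : wordSub w p ∈ S := by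
  induction w with
  | nil => exact hp
  | cons a w ih => exact hS.sub _ _ _ ih

variable [PavelkaAlgebra A] [SubstAlgebra I A]

theorem cyl_eq_of_notMem_dimSet {i : I} {p : A} (h : i ∉ dimSet I p) : SubstOps.cyl i p = p :=
  not_not.1 h

theorem sub_eq_of_notMem_dimSet {i : I} {p : A} (h : i ∉ dimSet I p) (m : I) :
    SubstOps.sub i m p = p := by
  rw [← cyl_eq_of_notMem_dimSet h, SubstAlgebra.sub_cyl_self]

theorem wordSub_map_collapse (T : List I) (m : I) {p : A} (hT : ∀ t ∈ T, t ∉ dimSet I p) :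
    wordSub (T.map (·, m)) p = p := by
  induction T with
  | nil => rfl
  | cons t T ih =>
    rw [List.map_cons, wordSub, ih fun s hs => hT s (List.mem_cons_of_mem _ hs),
      sub_eq_of_notMem_dimSet (hT t List.mem_cons_self)]

theorem dimSet_neg (p : A) : dimSet I (∼ₘp) ⊆ dimSet I p := by
  intro i hi hp
  apply hi
  rw [← hp, SubstAlgebra.cyl_neg_cyl]

theorem dimSet_oplus_self (p : A) : dimSet I (p ⊕ₘ p) ⊆ dimSet I p := by
  intro i hi hp
  apply hi
  have := (SubstAlgebra.quantifier (I := I) (A := A) i).oplus p p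
  rwa [hp] at this

theorem dimSet_tc (r : Set.Icc (0 : ℚ) 1) : dimSet I (TruthConst.tc r : A) = ∅ := by
  ext i
  simp [dimSet, (SubstAlgebra.quantifier (I := I) (A := A) i).tc]

theorem dimSet_cyl (i : I) (p : A) : dimSet I (SubstOps.cyl i p) ⊆ dimSet I p := by
  intro j hj hp
  apply hj
  rw [SubstAlgebra.cyl_comm, hp]

theorem notMem_dimSet_cyl (i : I) (p : A) : i ∉ dimSet I (SubstOps.cyl i p) :=
  not_not.2 (SubstAlgebra.cyl_cyl i p)

theorem notMem_dimSet_sub {i j k : I} {p : A} (hk : k ∉ dimSet I p) (hi : k ≠ i) (hj : k ≠ j) :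
    k ∉ dimSet I (SubstOps.sub i j p) := by
  refine not_not.2 ?_
  rw [← SubstAlgebra.sub_cyl_of_ne i j k p hi hj, cyl_eq_of_notMem_dimSet hk]

theorem sub_tc (i j : I) (r : Set.Icc (0 : ℚ) 1) :
    SubstOps.sub i j (TruthConst.tc r : A) = TruthConst.tc r :=
  sub_eq_of_notMem_dimSet (by rw [dimSet_tc]; exact Set.notMem_empty i) j

theorem wordSub_tc (w : List (I × I)) (r : Set.Icc (0 : ℚ) 1) :
    wordSub w (TruthConst.tc r : A) = TruthConst.tc r := by
  induction w with
  | nil => rfl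
  | cons p w ih => rw [wordSub, ih, sub_tc]

theorem wordSub_neg (w : List (I × I)) (p : A) : wordSub w (∼ₘp) = ∼ₘ(wordSub w p) := by
  induction w with
  | nil => rfl
  | cons a w ih => rw [wordSub, ih, (SubstAlgebra.endo a.1 a.2).neg, wordSub]

theorem wordSub_oplus (w : List (I × I)) (p q : A) :
    wordSub w (p ⊕ₘ q) = wordSub w p ⊕ₘ wordSub w q := by
  induction w with
  | nil => rfl
  | cons a w ih => rw [wordSub, ih, (SubstAlgebra.endo a.1 a.2).oplus, wordSub, wordSub]

theorem wordSub_odot (w : List (I × I)) (p q : A) :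
    wordSub w (p ⊙ₘ q) = wordSub w p ⊙ₘ wordSub w q := by
  rw [mv_odot_eq, wordSub_neg, wordSub_oplus, wordSub_neg, wordSub_neg, ← mv_odot_eq]

/-- If `Δp` is co-infinite, `s_τ p` depends on the restriction of `τ` to `Δp` only. -/
theorem wordSub_congr {p : A} (hp : (dimSet I p)ᶜ.Infinite) {w w' : List (I × I)}
    (h : Set.EqOn (wordFun w) (wordFun w') (dimSet I p)) : wordSub w p = wordSub w' p := by
  have hfin : {z | wordFun w z ≠ wordFun w' z}.Finite := by
    refine ((finite_wordFun_ne w).union (finite_wordFun_ne w')).subset fun z hz => ?_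
    by_contra hc
    simp only [Set.mem_union, Set.mem_ofPred_eq, not_or, not_not] at hc
    exact hz (hc.1.trans hc.2.symm)
  obtain ⟨m, -, hm⟩ := hp.exists_notMem_finset hfin.toFinset
  have hT : ∀ t ∈ hfin.toFinset.toList, t ∉ dimSet I p := by
    intro t ht htp
    rw [Finset.mem_toList, Set.Finite.mem_toFinset] at ht
    exact ht (h htp)
  -- Collapsing the disagreement set to `m`, a point where the words agree, does not change `p`, as
  -- that set misses `Δp`. After the collapse both words induce the same map.
  rw [← wordSub_map_collapse hfin.toFinset.toList m hT, ← wordSub_append, ← wordSub_append]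
  refine SubstAlgebra.sub_word _ _ ?_ p
  have hm' : m ∉ hfin.toFinset.toList := by rwa [Finset.mem_toList]
  funext z
  rw [wordFun_append, wordFun_append, Function.comp_apply, Function.comp_apply]
  by_cases hz : z ∈ hfin.toFinset.toList
  · rw [(wordFun_map_collapse _ hm' z).1 hz]
    by_contra hc
    exact hm (hfin.mem_toFinset.2 hc)
  · rw [(wordFun_map_collapse _ hm' z).2 hz]
    by_contra hc
    exact hz (Finset.mem_toList.2 (hfin.mem_toFinset.2 hc))

end Words

/-! ### Finite transformations approximated by words; independence of the auxiliary points. -/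

section FiniteTransformations

variable {I : Type u} [LinearOrder I]

theorem FinTrans.mem_moved (x : FinTrans I) (z : I) : z ∈ x.moved ↔ x.1 z ≠ z := by
  simp [FinTrans.moved]

theorem FinTrans.nodup_moved (x : FinTrans I) : x.moved.Nodup := Finset.sort_nodup _ _

/-- The word in the definition of `s_x p` represents `x` off the auxiliary points. -/
theorem FinTrans.wordFun_moved (x : FinTrans I) {π : List I} (hlen : π.length = x.moved.length)
    (hnd : π.Nodup) (hU : ∀ z ∈ π, z ∉ x.moved) (hW : ∀ z ∈ π, z ∉ x.moved.map x.1) {z : I}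
    (hz : z ∉ π) : wordFun (π.zip (x.moved.map x.1) ++ x.moved.zip π) z = x.1 z := by
  rw [wordFun_append, Function.comp_apply]
  by_cases hm : z ∈ x.moved
  · obtain ⟨n, hn, rfl⟩ := List.getElem_of_mem hm
    have hn' : n < π.length := by rw [hlen]; exact hn
    rw [wordFun_zip_getElem _ _ x.nodup_moved hU n hn hn',
      wordFun_zip_getElem _ _ hnd (fun v hv hvπ => hW v hvπ hv) n hn' (by simpa using hn),
      List.getElem_map]
  · rw [wordFun_zip_of_notMem _ _ hm, wordFun_zip_of_notMem _ _ hz]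
    by_contra hc
    exact hm ((x.mem_moved z).2 (Ne.symm hc))

/-- Up to collapsing finitely many points of a given infinite set, a finite transformation is a
composite of replacements. -/
theorem FinTrans.exists_word (x : FinTrans I) {N : Set I} (hN : N.Infinite) (m : I) :
    ∃ T : Finset I, ↑T ⊆ N ∧ m ∉ T ∧ ∃ w : List (I × I),
      ∀ z, wordFun w z = if z ∈ T then x.1 m else x.1 z := by
  have hN' : (N \ ({z | z ∈ x.moved} ∪ {z | z ∈ x.moved.map x.1} ∪ {m})).Infinite :=
    hN.sdiff (((List.finite_toSet _).union (List.finite_toSet _)).union (Set.finite_singleton m))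
  obtain ⟨T, hT, hcard⟩ := hN'.exists_subset_card_eq x.moved.length
  have hm : m ∉ T := fun h => (hT h).2 (Or.inr rfl)
  -- The word routes moved points through `T`, which spoils only the values on `T`; first collapsing
  -- `T` to `m` gives these the known value `x m`.
  refine ⟨T, fun z hz => (hT hz).1, hm,
    (T.toList.zip (x.moved.map x.1) ++ x.moved.zip T.toList) ++ T.toList.map (·, m), fun z => ?_⟩
  have key : ∀ z ∉ T, wordFun (T.toList.zip (x.moved.map x.1) ++ x.moved.zip T.toList) z =
      x.1 z := fun z hz => x.wordFun_moved (by simpa using hcard) T.nodup_toList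
    (fun z hz h => (hT (Finset.mem_toList.1 hz)).2 (Or.inl (Or.inl h)))
    (fun z hz h => (hT (Finset.mem_toList.1 hz)).2 (Or.inl (Or.inr h)))
    (by rwa [Finset.mem_toList])
  have hm' : m ∉ T.toList := by rwa [Finset.mem_toList]
  rw [wordFun_append, Function.comp_apply]
  split_ifs with hz
  · rw [(wordFun_map_collapse _ hm' z).1 (Finset.mem_toList.2 hz), key m hm]
  · rw [(wordFun_map_collapse _ hm' z).2 (fun h => hz (Finset.mem_toList.1 h)), key z hz]

theorem exists_word_eqOn {A : Type v} [SubstOps I A] {p : A} (hp : (dimSet I p)ᶜ.Infinite) (x : FinTrans I) :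
    ∃ w : List (I × I), Set.EqOn (wordFun w) x.1 (dimSet I p) := by
  obtain ⟨m, -⟩ := hp.nonempty
  obtain ⟨T, hT, -, w, hw⟩ := x.exists_word hp m
  refine ⟨w, fun z hz => ?_⟩
  have hzT : z ∉ T := fun h => hT h hz
  rw [hw, if_neg hzT]

variable [WellFoundedLT I] {A : Type v}

theorem firstElements_spec {S : Set I} (hS : S.Infinite) (k : ℕ) :
    (firstElements S k).length = k ∧ (firstElements S k).Nodup ∧
      ∀ z ∈ firstElements S k, z ∈ S := by
  induction k with
  | zero => simp [firstElements]
  | succ k ih =>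
    obtain ⟨h1, h2, h3⟩ := ih
    have hne : (S \ {i | i ∈ firstElements S k}).Nonempty :=
      (hS.sdiff (List.finite_toSet _)).nonempty
    have hmin := WellFounded.min_mem (wellFounded_lt (α := I)) _ hne
    rw [firstElements, dif_pos hne]
    refine ⟨by simp [h1], ?_, ?_⟩
    · rw [List.nodup_append]
      refine ⟨h2, List.nodup_singleton _, fun a ha b hb e => ?_⟩
      rw [List.mem_singleton] at hb
      rw [e, hb] at ha
      exact hmin.2 ha
    · intro z hz
      rcases List.mem_append.1 hz with hz | hz
      · exact h3 z hz
      · rw [List.mem_singleton.1 hz]; exact hmin.1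

theorem substOp_mem [MVOps A] [TruthConst A] [SubstOps I A] {S : Set A}
    (hS : IsSubuniverse I S) (x : FinTrans I) {p : A} (hp : p ∈ S) : substOp x p ∈ S :=
  wordSub_mem hS _ hp

variable [PavelkaAlgebra A] [SubstAlgebra I A]

/-- The auxiliary points lie outside `Δp`, so the defining word of `s_x p` agrees with `x` on `Δp`.
Hence any other word agreeing with `x` there gives the same result. -/
theorem substOp_eq_wordSub {p : A} (hp : (dimSet I p)ᶜ.Infinite) {x : FinTrans I}
    {w : List (I × I)} (h : Set.EqOn (wordFun w) x.1 (dimSet I p)) :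
    substOp x p = wordSub w p := by
  have hinf : (dimSet I p ∪ {i | i ∈ x.moved} ∪ {i | i ∈ x.moved.map x.1})ᶜ.Infinite := by
    rw [Set.union_assoc, Set.compl_union]
    exact hp.sdiff ((List.finite_toSet _).union (List.finite_toSet _))
  obtain ⟨h1, h2, h3⟩ := firstElements_spec hinf x.moved.length
  refine wordSub_congr hp fun z hz => ?_
  rw [h hz]
  exact x.wordFun_moved h1 h2 (fun y hy hU => h3 y hy (Or.inl (Or.inr hU)))
    (fun y hy hW => h3 y hy (Or.inr hW)) fun hzπ => h3 z hzπ (Or.inl (Or.inl hz))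

theorem substOp_congr {p : A} (hp : (dimSet I p)ᶜ.Infinite) {x y : FinTrans I}
    (h : Set.EqOn x.1 y.1 (dimSet I p)) : substOp x p = substOp y p := by
  obtain ⟨w, hw⟩ := exists_word_eqOn hp x
  rw [substOp_eq_wordSub hp hw, substOp_eq_wordSub hp (hw.trans h)]

end FiniteTransformations

/-! ### Inclusion-exclusion and modifications of finite transformations. -/

/-- An alternating sum over all subsets vanishes if the summand does not depend on the membership
of some element. -/
theorem sum_neg_one_pow_card_mul_eq_zero {ι : Type*} [Fintype ι] [DecidableEq ι]
    (g : Finset ι → ℝ) (i : ι) (h : ∀ S, g (insert i S) = g S) :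
    ∑ S : Finset ι, (-1 : ℝ) ^ S.card * g S = 0 := by
  refine Finset.sum_involution (fun S _ => if i ∈ S then S.erase i else insert i S)
    ?_ ?_ (fun _ _ => Finset.mem_univ _) ?_
  · intro S _
    by_cases hi : i ∈ S
    · have h1 := h (S.erase i)
      rw [Finset.insert_erase hi] at h1
      have h2 := Finset.card_erase_add_one hi
      simp only [if_pos hi]
      rw [h1, ← h2, pow_succ]
      ring
    · simp only [if_neg hi]
      rw [h S, Finset.card_insert_of_notMem hi, pow_succ]
      ring
  · intro S _ _ e
    by_cases hi : i ∈ S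
    · rw [if_pos hi] at e
      rw [← e] at hi
      exact Finset.notMem_erase i S hi
    · rw [if_neg hi] at e
      rw [← e] at hi
      exact hi (Finset.mem_insert_self i S)
  · intro S _
    by_cases hi : i ∈ S
    · simp [hi]
    · simp [hi]

section Collapse

variable {I : Type u}

open Classical in
/-- The composite of `x` with the map that sends the points of `T` to `m`. -/
noncomputable def FinTrans.collapse (x : FinTrans I) (T : Finset I) (m : I) : FinTrans I :=
  ⟨fun z => if z ∈ T then x.1 m else x.1 z, (T.finite_toSet.union x.2).subset fun z hz => by
    by_cases h : z ∈ T
    · exact Or.inl h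
    · refine Or.inr ?_
      change (if z ∈ T then x.1 m else x.1 z) ≠ z at hz
      rwa [if_neg h] at hz⟩

theorem FinTrans.collapse_of_mem (x : FinTrans I) {T : Finset I} (m : I) {z : I} (h : z ∈ T) :
    (x.collapse T m).1 z = x.1 m := if_pos h

theorem FinTrans.collapse_of_notMem (x : FinTrans I) {T : Finset I} (m : I) {z : I}
    (h : z ∉ T) : (x.collapse T m).1 z = x.1 z := if_neg h

open Classical in
/-- The transformation that agrees with `x` off `i` and maps `i` to `j`. -/
noncomputable def FinTrans.update (x : FinTrans I) (i j : I) : FinTrans I :=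
  ⟨Function.update x.1 i j, (x.2.insert i).subset fun z hz => by
    by_cases h : z = i
    · exact Or.inl h
    · refine Or.inr ?_
      change Function.update x.1 i j z ≠ z at hz
      rwa [Function.update_of_ne h] at hz⟩

theorem FinTrans.update_self (x : FinTrans I) (i j : I) : (x.update i j).1 i = j := by
  simp [FinTrans.update]

theorem FinTrans.update_of_ne (x : FinTrans I) {i z : I} (j : I) (h : z ≠ i) :
    (x.update i j).1 z = x.1 z := by
  simp [FinTrans.update, h]

end Collapse

/-! ### Transfer from words to finite transformations; the MV operations under `ψ`. -/

section Representation

variable {I : Type u} [LinearOrder I] [WellFoundedLT I] {A : Type v} [PavelkaAlgebra A]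
  [SubstAlgebra I A]

theorem psi_eq_of_eqOn {F : Set A} {p : A} (hp : (dimSet I p)ᶜ.Infinite) {x : FinTrans I}
    {w : List (I × I)} (h : Set.EqOn (wordFun w) x.1 (dimSet I p)) :
    (psi F p : FunAlg I) x = truthValue F (wordSub w p) := by
  rw [psi, substOp_eq_wordSub hp h]

/-- Linear relations between the values at composites of replacements extend to all finite
transformations.  The elements `b i` need not have a common index outside their dimension sets;
the relation at `x` follows by inclusion-exclusion from those at suitable collapses of `x`. -/
theorem sum_psi_eq_zero (hB : DimComplemented I A) {ι : Type*} [Fintype ι] [DecidableEq ι]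
    [Nonempty ι] (F : Set A) (b : ι → A) (c : ι → ℝ)
    (h : ∀ w : List (I × I), ∑ i, c i * (truthValue F (wordSub w (b i)) : ℝ) = 0)
    (x : FinTrans I) : ∑ i, c i * ((psi F (b i) : FunAlg I) x : ℝ) = 0 := by
  obtain ⟨i₀⟩ := ‹Nonempty ι›
  obtain ⟨m, -⟩ := (hB (b i₀)).nonempty
  choose T hT hm w hw using fun i => x.exists_word (hB (b i)) m
  set y : Finset ι → FinTrans I := fun S => x.collapse (S.biUnion T) m with hy
  have hmem : ∀ S : Finset ι, m ∉ S.biUnion T := fun S hS => by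
    obtain ⟨i, -, hi⟩ := Finset.mem_biUnion.1 hS
    exact hm i hi
  -- `T i` misses the dimension set of `b i`, so collapsing it as well is invisible to `b i`.
  have hins : ∀ i S, (psi F (b i) : FunAlg I) (y (insert i S)) = psi F (b i) (y S) := by
    intro i S
    rw [psi, psi]
    congr 1
    refine substOp_congr (hB (b i)) fun z hz => ?_
    have hzi : z ∉ T i := fun hzT => hT i hzT hz
    by_cases hzS : z ∈ S.biUnion T
    · have : z ∈ (insert i S).biUnion T := by
        rw [Finset.biUnion_insert]; exact Finset.mem_union_right _ hzS
      rw [hy]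
      simp only
      rw [x.collapse_of_mem m hzS, x.collapse_of_mem m this]
    · have : z ∉ (insert i S).biUnion T := by
        rw [Finset.biUnion_insert, Finset.mem_union]; exact not_or.2 ⟨hzi, hzS⟩
      rw [hy]
      simp only
      rw [x.collapse_of_notMem m hzS, x.collapse_of_notMem m this]
  -- For `i ∈ S`, the word `w i` differs from `x` only on `T i`, and all of `T i` is collapsed
  -- beforehand.
  have hword : ∀ S : Finset ι, S.Nonempty → ∃ w, wordFun w = (y S).1 := by
    rintro S ⟨i, hi⟩
    refine ⟨w i ++ (S.biUnion T).toList.map (·, m), funext fun z => ?_⟩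
    have hm' : m ∉ (S.biUnion T).toList := fun hmS => hmem S (Finset.mem_toList.1 hmS)
    rw [wordFun_append, Function.comp_apply]
    by_cases hz : z ∈ S.biUnion T
    · rw [(wordFun_map_collapse _ hm' z).1 (Finset.mem_toList.2 hz), hw, if_neg (hm i)]
      exact (x.collapse_of_mem m hz).symm
    · have hzi : z ∉ T i := fun hzT => hz (Finset.mem_biUnion.2 ⟨i, hi, hzT⟩)
      rw [(wordFun_map_collapse _ hm' z).2 (fun hzS => hz (Finset.mem_toList.1 hzS)), hw,
        if_neg hzi]
      exact (x.collapse_of_notMem m hz).symm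
  have hsum : ∑ S : Finset ι, (-1 : ℝ) ^ S.card *
      ∑ i, c i * ((psi F (b i) : FunAlg I) (y S) : ℝ) = 0 := by
    simp_rw [Finset.mul_sum]
    rw [Finset.sum_comm]
    refine Finset.sum_eq_zero fun i _ => ?_
    exact sum_neg_one_pow_card_mul_eq_zero
      (fun S => c i * ((psi F (b i) : FunAlg I) (y S) : ℝ)) i fun S => by
        simp only [hins]
  -- Nonempty `S` contribute zero by the relation at words; the remaining term is the relation at `y
  -- ∅ = x`.
  rw [Finset.sum_eq_single ∅] at hsum
  · have hx : y ∅ = x := Subtype.ext (funext fun z => x.collapse_of_notMem m (by simp))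
    rw [hx] at hsum
    simpa using hsum
  · intro S _ hS
    obtain ⟨v, hv⟩ := hword S (Finset.nonempty_iff_ne_empty.2 hS)
    have := h v
    have e : ∀ i, (psi F (b i) : FunAlg I) (y S) = truthValue F (wordSub v (b i)) := fun i =>
      psi_eq_of_eqOn (hB _) (by rw [hv]; exact Set.eqOn_refl _ _)
    simp only [e, this, mul_zero]
  · simp

variable {S F : Set A}

theorem psi_tc (hF : IsMaximalFilterOf S F) (hS : IsSubuniverse I S)
    (r : Set.Icc (0 : ℚ) 1) :
    (psi F (TruthConst.tc r : A) : FunAlg I) = TruthConst.tc r := by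
  funext x
  change truthValue F (wordSub _ _) = ratVal r
  rw [wordSub_tc, hF.truthValue_tc hS]

/-- Since `Δ(¬p) ⊆ Δp`, one word represents `x` for both elements; this is what fails for binary
operations. -/
theorem psi_neg (hB : DimComplemented I A) (hF : IsMaximalFilterOf S F)
    (hS : IsSubuniverse I S) {p : A} (hp : p ∈ S) (x : FinTrans I) :
    (psi F (∼ₘp) : FunAlg I) x = ∼ₘ((psi F p : FunAlg I) x) := by
  obtain ⟨w, hw⟩ := exists_word_eqOn (hB p) x
  rw [psi_eq_of_eqOn (hB p) hw, psi_eq_of_eqOn (hB _) (hw.mono (dimSet_neg p)), wordSub_neg,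
    hF.truthValue_neg hS (wordSub_mem hS w hp)]

theorem psi_oplus_self (hB : DimComplemented I A) (hF : IsMaximalFilterOf S F)
    (hS : IsSubuniverse I S) {p : A} (hp : p ∈ S) (x : FinTrans I) :
    (psi F (p ⊕ₘ p) : FunAlg I) x = (psi F p : FunAlg I) x ⊕ₘ (psi F p : FunAlg I) x := by
  obtain ⟨w, hw⟩ := exists_word_eqOn (hB p) x
  have hmem := wordSub_mem hS w hp
  rw [psi_eq_of_eqOn (hB p) hw, psi_eq_of_eqOn (hB _) (hw.mono (dimSet_oplus_self p)),
    wordSub_oplus, hF.truthValue_oplus hS hmem hmem]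

/-- Additivity: `ψ(p) + ψ(q) = ψ(p ⊕ q) + ψ(p ⊙ q)`. -/
theorem psi_add_psi (hB : DimComplemented I A) (hF : IsMaximalFilterOf S F)
    (hS : IsSubuniverse I S) {p q : A} (hp : p ∈ S) (hq : q ∈ S) (x : FinTrans I) :
    ((psi F p : FunAlg I) x : ℝ) + ((psi F q : FunAlg I) x : ℝ) =
      ((psi F (p ⊕ₘ q) : FunAlg I) x : ℝ) + ((psi F (p ⊙ₘ q) : FunAlg I) x : ℝ) := by
  -- At each word the relation is the identity `s + t = min (s + t) 1 + max (s + t - 1) 0` for the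
  -- truth values.
  have := sum_psi_eq_zero hB F ![p, q, p ⊕ₘ q, p ⊙ₘ q] ![1, 1, -1, -1] (fun w => by
    have h1 := wordSub_mem hS w hp
    have h2 := wordSub_mem hS w hq
    simp only [Fin.sum_univ_four, Matrix.cons_val, wordSub_oplus, wordSub_odot,
      hF.truthValue_oplus hS h1 h2, hF.truthValue_odot hS h1 h2]
    simp only [MVOps.oplus, MVOps.odot]
    grind) x
  simp only [Fin.sum_univ_four, Matrix.cons_val] at this
  linarith

/-- Elements that are disjoint at all composites of replacements. -/
theorem psi_add_le_one_of_disjoint (hB : DimComplemented I A) (hF : IsMaximalFilterOf S F)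
    (hS : IsSubuniverse I S) {p q : A} (hp : p ∈ S) (hq : q ∈ S)
    (hd : ∀ w : List (I × I), (truthValue F (wordSub w p) : ℝ) = 0 ∨
      (truthValue F (wordSub w q) : ℝ) = 0) (x : FinTrans I) :
    ((psi F p : FunAlg I) x : ℝ) + ((psi F q : FunAlg I) x : ℝ) ≤ 1 := by
  rw [psi_add_psi hB hF hS hp hq]
  -- The single element `p ⊙ q` has its own word, at which disjointness makes its value `0`.
  obtain ⟨w, hw⟩ := exists_word_eqOn (hB (p ⊙ₘ q)) x
  rw [psi_eq_of_eqOn (hB (p ⊙ₘ q)) hw, wordSub_odot,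
    hF.truthValue_odot hS (wordSub_mem hS w hp) (wordSub_mem hS w hq)]
  have h1 := ((psi F (p ⊕ₘ q) : FunAlg I) x).2.2
  have h2 := (truthValue F (wordSub w p)).2.2
  have h3 := (truthValue F (wordSub w q)).2.2
  have h4 : max ((truthValue F (wordSub w p) : ℝ) + truthValue F (wordSub w q) - 1) 0 = 0 := by
    rcases hd w with h | h <;> rw [h] <;> exact max_eq_right (by linarith)
  change _ + max ((truthValue F (wordSub w p) : ℝ) + truthValue F (wordSub w q) - 1) 0 ≤ 1
  rw [h4]
  linarith

/-- Replacing `p`, `q` by `p ⊕ p`, `q ⊕ q` keeps them disjoint at words and doubles their values at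
`x`, up to truncation. Two positive values would both reach `1`, contradicting the bound `1` on
their sum. -/
theorem psi_eq_zero_of_disjoint (hB : DimComplemented I A) (hF : IsMaximalFilterOf S F)
    (hS : IsSubuniverse I S) {p q : A} (hp : p ∈ S) (hq : q ∈ S)
    (hd : ∀ w : List (I × I), (truthValue F (wordSub w p) : ℝ) = 0 ∨
      (truthValue F (wordSub w q) : ℝ) = 0) (x : FinTrans I) :
    ((psi F p : FunAlg I) x : ℝ) = 0 ∨ ((psi F q : FunAlg I) x : ℝ) = 0 := by
  have key : ∀ n : ℕ, ∀ p ∈ S, ∀ q ∈ S, (∀ w : List (I × I),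
      (truthValue F (wordSub w p) : ℝ) = 0 ∨ (truthValue F (wordSub w q) : ℝ) = 0) →
      (1 / 2 : ℝ) ^ n ≤ (psi F p : FunAlg I) x → (1 / 2 : ℝ) ^ n ≤ (psi F q : FunAlg I) x →
      False := by
    intro n
    induction n with
    | zero =>
      intro p hp q hq hd h1 h2
      have := psi_add_le_one_of_disjoint hB hF hS hp hq hd x
      rw [pow_zero] at h1 h2
      linarith
    | succ n ih =>
      intro p hp q hq hd h1 h2
      have hpow : (1 / 2 : ℝ) ^ n ≤ 1 := pow_le_one₀ (by norm_num) (by norm_num)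
      refine ih _ (hS.oplus _ hp _ hp) _ (hS.oplus _ hq _ hq) (fun w => ?_) ?_ ?_
      · have h1 := wordSub_mem hS w hp
        have h2 := wordSub_mem hS w hq
        rw [wordSub_oplus, wordSub_oplus, hF.truthValue_oplus hS h1 h1,
          hF.truthValue_oplus hS h2 h2]
        simp only [MVOps.oplus]
        refine (hd w).imp (fun h => ?_) (fun h => ?_) <;> rw [h] <;> norm_num
      · rw [psi_oplus_self hB hF hS hp]
        rw [pow_succ] at h1
        exact le_min (by linarith) hpow
      · rw [psi_oplus_self hB hF hS hq]
        rw [pow_succ] at h2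
        exact le_min (by linarith) hpow
  by_contra! hne
  have h1 := lt_of_le_of_ne ((psi F p : FunAlg I) x).2.1 hne.1.symm
  have h2 := lt_of_le_of_ne ((psi F q : FunAlg I) x).2.1 hne.2.symm
  obtain ⟨n, hn⟩ := exists_pow_lt_of_lt_one (lt_min h1 h2) (show (1 / 2 : ℝ) < 1 by norm_num)
  exact key n p hp q hq hd (hn.le.trans (min_le_left _ _)) (hn.le.trans (min_le_right _ _))

theorem psi_oplus (hB : DimComplemented I A) (hF : IsMaximalFilterOf S F)
    (hS : IsSubuniverse I S) {p q : A} (hp : p ∈ S) (hq : q ∈ S) (x : FinTrans I) :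
    (psi F (p ⊕ₘ q) : FunAlg I) x = (psi F p : FunAlg I) x ⊕ₘ (psi F q : FunAlg I) x := by
  have hadd := psi_add_psi hB hF hS hp hq x
  have hs := hS.oplus _ hp _ hq
  -- At a word, if `p ⊙ q` has positive value then `p ⊕ q` has value `1`. Transferred to `x`: either
  -- `ψ(p ⊙ q)` is `0` or `ψ(p ⊕ q)` is `1`, and additivity decides each case.
  have hd := psi_eq_zero_of_disjoint hB hF hS (hS.odot _ hp _ hq) (hS.neg _ hs) (fun w => by
    have h1 := wordSub_mem hS w hp
    have h2 := wordSub_mem hS w hq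
    rw [wordSub_odot, wordSub_neg, wordSub_oplus, hF.truthValue_odot hS h1 h2,
      hF.truthValue_neg hS (hS.oplus _ h1 _ h2), hF.truthValue_oplus hS h1 h2]
    simp only [MVOps.oplus, MVOps.odot, MVOps.neg]
    grind) x
  rw [psi_neg hB hF hS hs] at hd
  replace hd : ((psi F (p ⊙ₘ q) : FunAlg I) x : ℝ) = 0 ∨
      1 - ((psi F (p ⊕ₘ q) : FunAlg I) x : ℝ) = 0 := hd
  have h1 := ((psi F (p ⊕ₘ q) : FunAlg I) x).2.2
  have h2 := ((psi F (p ⊙ₘ q) : FunAlg I) x).2.1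
  refine Subtype.ext ?_
  change ((psi F (p ⊕ₘ q) : FunAlg I) x : ℝ) =
    min (((psi F p : FunAlg I) x : ℝ) + ((psi F q : FunAlg I) x : ℝ)) 1
  rw [hadd]
  rcases hd with h | h
  · rw [h, add_zero, min_eq_left h1]
  · rw [min_eq_right (by linarith)]
    linarith

theorem psi_odot (hB : DimComplemented I A) (hF : IsMaximalFilterOf S F)
    (hS : IsSubuniverse I S) {p q : A} (hp : p ∈ S) (hq : q ∈ S) (x : FinTrans I) :
    (psi F (p ⊙ₘ q) : FunAlg I) x = (psi F p : FunAlg I) x ⊙ₘ (psi F q : FunAlg I) x := by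
  rw [mv_odot_eq, psi_neg hB hF hS (hS.oplus _ (hS.neg _ hp) _ (hS.neg _ hq)),
    psi_oplus hB hF hS (hS.neg _ hp) (hS.neg _ hq), psi_neg hB hF hS hp, psi_neg hB hF hS hq,
    ← mv_odot_eq]

end Representation

/-! ### Monotonicity of substitutions and truth values. -/

section Monotonicity

variable {I : Type u} {A : Type v} [PavelkaAlgebra A] [SubstAlgebra I A] {S F : Set A}

theorem wordSub_mono (w : List (I × I)) {a b : A} (h : mvLE a b) :
    mvLE (wordSub w a) (wordSub w b) := by
  rw [← mvImp_eq_one_iff] at h ⊢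
  have := congrArg (wordSub w) h
  rwa [← tc_one, wordSub_tc, tc_one, mvImp, wordSub_oplus, wordSub_neg] at this

theorem IsMaximalFilterOf.truthValue_mono (hF : IsMaximalFilterOf S F)
    (hS : IsSubuniverse I S) {a b : A} (hb : b ∈ S) (h : mvLE a b) :
    (truthValue F a : ℝ) ≤ truthValue F b := by
  refine Real.sSup_le ?_ (truthValue F b).2.1
  rintro t ⟨r, rfl, hr⟩
  exact le_truthValue (hF.filter.mvImp_trans hS (hS.tc r) hb hr (hF.filter.mvImp_of_le hS h))

end Monotonicity

/-! ### Substitutions and cylindrifications under `ψ`. -/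

section Homomorphism

variable {I : Type u} [LinearOrder I] [WellFoundedLT I] {A : Type v} [PavelkaAlgebra A]
  [SubstAlgebra I A] {S F : Set A}

theorem psi_sub (hB : DimComplemented I A) (F : Set A) (i j : I) (p : A) :
    (psi F (SubstOps.sub i j p) : FunAlg I) = SubstOps.sub i j (psi F p : FunAlg I) := by
  funext x
  -- Keeping `T` away from `i` and `j` as well lets one word `w` serve both sides: `w` represents
  -- `x` on `Δ(s_{[i|j]} p)`, and `w` after `[i|j]` represents `x ∘ [i|j]` on `Δp`.
  have hN : ((dimSet I p)ᶜ \ {i, j}).Infinite := (hB p).sdiff (Set.toFinite _)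
  obtain ⟨T, hT, -, w, hw⟩ := x.exists_word hN i
  have hTi : i ∉ T := fun h => (hT h).2 (by simp)
  have hTj : j ∉ T := fun h => (hT h).2 (by simp)
  have h1 : Set.EqOn (wordFun w) x.1 (dimSet I (SubstOps.sub i j p)) := fun z hz => by
    have hzT : z ∉ T := fun h => notMem_dimSet_sub (hT h).1
      (fun e => (hT h).2 (by simp [e])) (fun e => (hT h).2 (by simp [e])) hz
    rw [hw, if_neg hzT]
  have h2 : Set.EqOn (wordFun (w ++ [(i, j)])) (x.compReplacement i j).1 (dimSet I p) :=
    fun z hz => by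
      have hzT : replacement i j z ∉ T := by
        by_cases h : z = i
        · rwa [h, replacement_self]
        · rw [replacement_of_ne j h]
          exact fun h => (hT h).1 hz
      rw [wordFun_append]
      change wordFun w (replacement i j z) = x.1 (replacement i j z)
      rw [hw, if_neg hzT]
  change _ = (psi F p : FunAlg I) (x.compReplacement i j)
  rw [psi_eq_of_eqOn (hB _) h1, psi_eq_of_eqOn (hB _) h2, wordSub_append]
  rfl

/-- As `i ∉ Δ(c_i p)`, the value of `c_i p` is the same at `x` and `y`; at `y`, one word serves `p`
and `c_i p`, and `p ≤ c_i p`. -/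
theorem psi_le_psi_cyl (hB : DimComplemented I A) (hF : IsMaximalFilterOf S F)
    (hS : IsSubuniverse I S) (i : I) {p : A} (hp : p ∈ S) {x y : FinTrans I}
    (hxy : ∀ j, j ≠ i → y.1 j = x.1 j) :
    ((psi F p : FunAlg I) y : ℝ) ≤ (psi F (SubstOps.cyl i p) : FunAlg I) x := by
  have hxy' : Set.EqOn x.1 y.1 (dimSet I (SubstOps.cyl i p)) := fun z hz =>
    (hxy z (fun e => notMem_dimSet_cyl i p (e ▸ hz))).symm
  obtain ⟨w, hw⟩ := exists_word_eqOn (hB p) y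
  have e : (psi F (SubstOps.cyl i p) : FunAlg I) x = (psi F (SubstOps.cyl i p) : FunAlg I) y := by
    rw [psi, psi, substOp_congr (hB _) hxy']
  rw [e, psi_eq_of_eqOn (hB p) hw, psi_eq_of_eqOn (hB _) (hw.mono (dimSet_cyl i p))]
  exact hF.truthValue_mono hS (wordSub_mem hS w (hS.cyl i p hp))
    (wordSub_mono w ((SubstAlgebra.quantifier i).le p))

/-- The Henkin property provides witnesses for the values of `c_i p`. -/
theorem exists_le_psi_of_tc_imp_mem (hB : DimComplemented I A) (hS : IsSubuniverse I S)
    (hH : IsHenkin I S F) (i : I) {p : A} (hp : p ∈ S) (x : FinTrans I)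
    {r : Set.Icc (0 : ℚ) 1}
    (hr : mvImp (TruthConst.tc r) (substOp x (SubstOps.cyl i p)) ∈ F) :
    ∃ y : FinTrans I, (∀ j, j ≠ i → y.1 j = x.1 j) ∧
      ((r : ℚ) : ℝ) ≤ (psi F p : FunAlg I) y := by
  -- The index `j` is outside `Δp`, fixed by `x`, not the image of a moved point, and different from
  -- `i`; thus `x` takes the value `j` only at `j`.
  obtain ⟨j, hj, hj'⟩ := ((hB p).sdiff
    ((x.2.union (x.2.image x.1)).union (Set.finite_singleton i))).nonempty
  simp only [Set.mem_union, not_or, Set.mem_singleton_iff, Set.mem_ofPred_eq, not_not] at hj'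
  obtain ⟨⟨hxj, himg⟩, hji⟩ := hj'
  -- Redirecting `i` to `j` and `j` to `i` makes `i` the only preimage of `j`: the set `T` is
  -- collapsed to `j`, so its points also go to `i`.
  obtain ⟨T, hT, hjT, w, hw⟩ := ((x.update i j).update j i).exists_word
    ((hB p).sdiff (Set.finite_singleton i)) j
  have hiT : i ∉ T := fun h => (hT h).2 rfl
  have hwi : wordFun w i = j := by
    rw [hw, if_neg hiT, FinTrans.update_of_ne _ _ (Ne.symm hji), FinTrans.update_self]
  have hwz : ∀ z, z ≠ i → z ≠ j → z ∉ T → wordFun w z = x.1 z := fun z h1 h2 h3 => by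
    rw [hw, if_neg h3, FinTrans.update_of_ne _ _ h2, FinTrans.update_of_ne _ _ h1]
  have hxz : ∀ z, z ≠ j → x.1 z ≠ j := fun z h e => by
    by_cases hz : x.1 z = z
    · exact h (hz.symm.trans e)
    · exact himg ⟨z, hz, e⟩
  have hpre : wordFun w ⁻¹' {j} = {i} := by
    ext z
    rw [Set.mem_preimage, Set.mem_singleton_iff, Set.mem_singleton_iff]
    refine ⟨fun h => ?_, fun h => h ▸ hwi⟩
    by_contra hzi
    by_cases hzT : z ∈ T
    · rw [hw, if_pos hzT, FinTrans.update_self] at h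
      exact hji h.symm
    · by_cases hzj : z = j
      · rw [hzj, hw, if_neg hjT, FinTrans.update_self] at h
        exact hji h.symm
      · rw [hwz z hzi hzj hzT] at h
        exact hxz z hzj h
  have hdim : ∀ z ∈ dimSet I p, z ≠ j ∧ z ∉ T := fun z hz =>
    ⟨fun e => hj (e ▸ hz), fun h => (hT h).1 hz⟩
  have hEq : Set.EqOn (wordFun w) x.1 (dimSet I (SubstOps.cyl i p)) := fun z hz => by
    obtain ⟨h1, h2⟩ := hdim z (dimSet_cyl i p hz)
    exact hwz z (fun e => notMem_dimSet_cyl i p (e ▸ hz)) h1 h2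
  rw [substOp_eq_wordSub (hB _) hEq, SubstAlgebra.sub_cyl_comm w i j hpre] at hr
  have hq := SubstAlgebra.quantifier (I := I) (A := A) j
  -- The quantifier passes through an implication from a constant, so the Henkin property applies to
  -- the whole implication and preserves the bound `r`.
  have hcyl : SubstOps.cyl j (mvImp (TruthConst.tc r) (wordSub w p)) =
      mvImp (TruthConst.tc r) (SubstOps.cyl j (wordSub w p)) := by
    have := hq.oplus (wordSub w p) (TruthConst.tc (∼ₘr))
    rwa [hq.tc, PavelkaAlgebra.tc_neg, MVAlgebra.oplus_comm,
      MVAlgebra.oplus_comm (SubstOps.cyl j (wordSub w p))] at this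
  rw [← hcyl] at hr
  obtain ⟨l, -, hl⟩ := hH j _ (hS.imp (hS.tc r) (wordSub_mem hS w hp)) hr
  refine ⟨x.update i l, fun k hk => x.update_of_ne l hk, ?_⟩
  -- Following `w` by `[j|l]` sends `i` to `l` and leaves the other values on `Δp` alone, as none of
  -- them is `j`.
  have hy : Set.EqOn (wordFun ((j, l) :: w)) (x.update i l).1 (dimSet I p) := fun z hz => by
    rw [wordFun, Function.comp_apply]
    by_cases hzi : z = i
    · rw [hzi, hwi, replacement_self, FinTrans.update_self]
    · obtain ⟨h1, h2⟩ := hdim z hz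
      rw [hwz z hzi h1 h2, replacement_of_ne _ (hxz z h1), x.update_of_ne l hzi]
  rw [psi_eq_of_eqOn (hB p) hy]
  rw [mvImp, (SubstAlgebra.endo j l).oplus, (SubstAlgebra.endo j l).neg, sub_tc] at hl
  exact le_truthValue hl

theorem psi_cyl (hB : DimComplemented I A) (hF : IsMaximalFilterOf S F)
    (hS : IsSubuniverse I S) (hH : IsHenkin I S F) (i : I) {p : A} (hp : p ∈ S) :
    (psi F (SubstOps.cyl i p) : FunAlg I) = SubstOps.cyl i (psi F p : FunAlg I) := by
  funext x
  refine Subtype.ext (le_antisymm ?_ ?_)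
  -- Only rationals strictly below the value are tested: for these the implication from the constant
  -- is certain to lie in `F`.
  · refine le_of_forall_rat_lt_imp_le fun q hq => ?_
    by_cases hq0 : 0 ≤ q
    · have hq1 : q ≤ 1 := by
        exact_mod_cast (hq.trans_le ((psi F (SubstOps.cyl i p) : FunAlg I) x).2.2).le
      obtain ⟨y, hy, hqy⟩ := exists_le_psi_of_tc_imp_mem hB hS hH i hp x (r := ⟨q, hq0, hq1⟩)
        (hF.tc_imp_mem_of_lt hS (substOp_mem hS x (hS.cyl i p hp)) hq)
      refine hqy.trans (le_csSup ⟨1, ?_⟩ ⟨y, hy, rfl⟩)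
      rintro t ⟨z, -, rfl⟩
      exact ((psi F p : FunAlg I) z).2.2
    · have : (q : ℝ) ≤ 0 := by exact_mod_cast (not_le.1 hq0).le
      exact this.trans (SubstOps.cyl i (psi F p : FunAlg I) x).2.1
  · refine Real.sSup_le ?_ ((psi F (SubstOps.cyl i p) : FunAlg I) x).2.1
    rintro t ⟨y, hy, rfl⟩
    exact psi_le_psi_cyl hB hF hS i hp hy

/-- The representation given by a Henkin maximal filter. -/
theorem isHomOn_psi (hB : DimComplemented I A) (hF : IsMaximalFilterOf S F)
    (hS : IsSubuniverse I S) (hH : IsHenkin I S F) : IsHomOn I S (psi F : A → FunAlg I) where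
  zero := by
    rw [← PavelkaAlgebra.tc_zero, psi_tc hF hS, PavelkaAlgebra.tc_zero]
  one := by
    rw [← tc_one, psi_tc hF hS, tc_one]
  tc := psi_tc hF hS
  neg _ hp := funext fun x => psi_neg hB hF hS hp x
  oplus _ hp _ hq := funext fun x => psi_oplus hB hF hS hp hq x
  odot _ hp _ hq := funext fun x => psi_odot hB hF hS hp hq x
  cyl i _ hp := psi_cyl hB hF hS hH i hp
  sub i j p _ := psi_sub hB F i j p

end Homomorphism

/-! ### Maximal extensions of filters, restriction to `S₀`, and Henkin witnesses. -/

section Extension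

variable {I : Type u} {A : Type v} [PavelkaAlgebra A] [SubstOps I A]

theorem IsFilterOf.exists_maximal {S F : Set A} (hF : IsFilterOf S F) (hS : IsSubuniverse I S)
    (h0 : MVOps.zero ∉ F) : ∃ G, IsMaximalFilterOf S G ∧ F ⊆ G := by
  have hchain : ∀ c ⊆ {G | IsFilterOf S G ∧ MVOps.zero ∉ G}, IsChain (· ⊆ ·) c → c.Nonempty →
      ∃ ub ∈ {G | IsFilterOf S G ∧ MVOps.zero ∉ G}, ∀ s ∈ c, s ⊆ ub := by
    intro c hc hchain hne
    refine ⟨⋃₀ c, ⟨⟨?_, ?_, ?_, ?_⟩, ?_⟩, fun s hs => Set.subset_sUnion_of_mem hs⟩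
    · exact Set.sUnion_subset fun s hs => (hc hs).1.subset
    · obtain ⟨s, hs⟩ := hne
      exact (hc hs).1.nonempty.mono (Set.subset_sUnion_of_mem hs)
    · rintro a ⟨s, hs, ha⟩ b ⟨t, ht, hb⟩
      rcases hchain.total hs ht with h | h
      · exact ⟨t, ht, (hc ht).1.odot _ (h ha) _ hb⟩
      · exact ⟨s, hs, (hc hs).1.odot _ ha _ (h hb)⟩
    · rintro a ⟨s, hs, ha⟩ b hb hab
      exact ⟨s, hs, (hc hs).1.upward a ha b hb hab⟩
    · rintro ⟨s, hs, h⟩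
      exact (hc hs).2 h
  obtain ⟨G, hFG, hG⟩ := zorn_subset_nonempty _ hchain F ⟨hF, h0⟩
  refine ⟨G, ⟨hG.prop.1, fun e => hG.prop.2 (e ▸ hS.zero), fun G' hG' hle hne => ?_⟩, hFG⟩
  exact (hG.le_of_ge ⟨hG', fun h => hne (hG'.eq_of_zero_mem h)⟩ hle).antisymm hle

/-- A maximal filter of a subalgebra `S₀` of `S` that contains `H ∩ S₀` has, together with the
filter `H` of `S`, a maximal extension. -/
theorem IsMaximalFilterOf.exists_extension {S S₀ H Hs : Set A} (hM : IsMaximalFilterOf S₀ Hs)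
    (hS : IsSubuniverse I S) (hS₀ : IsSubuniverse I S₀) (hsub : S₀ ⊆ S) (hH : IsFilterOf S H)
    (hHs : H ∩ S₀ ⊆ Hs) : ∃ F, IsMaximalFilterOf S F ∧ H ∪ Hs ⊆ F := by
  have h1 := hH.one_mem hS
  have h2 := hM.filter.one_mem hS₀
  obtain ⟨F, hF, hle⟩ := (isFilterOf_filterJoin hS hH.odot hM.filter.odot h1 h2).exists_maximal
    hS (by
      -- If `h ⊙ g ≤ 0`, then `h ≤ ¬g`, so `¬g ∈ H ∩ S₀ ⊆ Hs`, which is impossible next to `g ∈ Hs`.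
      rintro ⟨-, h, hh, g, hg, h0⟩
      have hgS := hS₀.neg _ (hM.filter.subset hg)
      have hle := mvLE_odot_iff.1 h0
      rw [mvImp, MVAlgebra.oplus_zero] at hle
      have hng := hHs ⟨hH.upward h hh _ (hsub hgS) hle, hgS⟩
      have := hM.filter.odot _ hg _ hng
      rw [MVAlgebra.odot_neg] at this
      exact hM.zero_notMem this)
  exact ⟨F, hF, Set.union_subset ((subset_filterJoin_left hH.subset h2).trans hle)
    ((subset_filterJoin_right (hM.filter.subset.trans hsub) h1).trans hle)⟩

/-- Proper filters extending a maximal filter of a subalgebra agree with it there. -/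
theorem IsMaximalFilterOf.mem_iff_of_subset {S S₀ F Hs : Set A} (hM : IsMaximalFilterOf S₀ Hs)
    (hS₀ : IsSubuniverse I S₀) (hsub : S₀ ⊆ S) (hF : IsMaximalFilterOf S F) (hle : Hs ⊆ F)
    {c : A} (hc : c ∈ S₀) : c ∈ F ↔ c ∈ Hs := by
  refine ⟨fun h => ?_, fun h => hle h⟩
  -- The trace of `F` on `S₀` is a proper filter above `Hs`, hence equal to it by maximality.
  have hG : IsFilterOf S₀ (F ∩ S₀) :=
    ⟨Set.inter_subset_right, hM.filter.nonempty.mono fun a ha => ⟨hle ha, hM.filter.subset ha⟩,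
      fun a ha b hb => ⟨hF.filter.odot _ ha.1 _ hb.1, hS₀.odot _ ha.2 _ hb.2⟩,
      fun a ha b hb hab => ⟨hF.filter.upward a ha.1 b (hsub hb) hab, hb⟩⟩
  rw [← hM.maximal _ hG (fun a ha => ⟨hle ha, hM.filter.subset ha⟩)
    (fun e => hF.zero_notMem (e.symm ▸ hS₀.zero : MVOps.zero ∈ F ∩ S₀).1)]
  exact ⟨h, hc⟩

theorem truthValue_eq_of_mem_iff {S₀ F₁ F₂ : Set A} (hS₀ : IsSubuniverse I S₀)
    (h : ∀ c ∈ S₀, c ∈ F₁ ↔ c ∈ F₂) {c : A} (hc : c ∈ S₀) :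
    truthValue F₁ c = truthValue F₂ c := by
  have e : ∀ r, mvImp (TruthConst.tc r) c ∈ F₁ ↔ mvImp (TruthConst.tc r) c ∈ F₂ :=
    fun r => h _ (hS₀.imp (hS₀.tc r) hc)
  simp only [truthValue, e]

/-- Maximal filters containing the witness set are Henkin. -/
theorem isHenkin_of_witnessSet {S F : Set A} (hS : IsSubuniverse I S)
    (hF : IsMaximalFilterOf S F) {a : A} {k w : I → I} {x : I → A} (hx : Enumerates S k x)
    (hw : ∀ i, w i ∉ dimSet I (x i)) (hle : filterGen S (witnessSet a k x w) ⊆ F) :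
    IsHenkin I S F := by
  intro j z hz hc
  obtain ⟨i, rfl, rfl⟩ := hx.2 j z hz
  refine ⟨w i, hw i, hF.filter.mp hc (hle (mem_filterGen (Or.inr ⟨i, rfl⟩) ?_))
    (hS.sub _ _ _ hz)⟩
  exact hS.imp (hS.cyl _ _ hz) (hS.sub _ _ _ hz)

end Extension

/-! ### Assembly of the two parts of the theorem. -/

theorem mainTheorem8 {I : Type u} [LinearOrder I] [WellFoundedLT I] {B : Type v}
    [PavelkaAlgebra B] [SubstAlgebra I B] (hB : DimComplemented I B) :
    (∀ P : Set B, IsMaximalFilterOf Set.univ P → IsHenkin I Set.univ P →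
      IsHomOn I Set.univ (psi P : B → FunAlg I)) ∧
    (∀ (X₁ X₂ : Set B), ∀ a ∈ Sg I X₁, ∀ b ∈ Sg I X₂,
      ∀ (k l : I → I) (x y : I → B) (w w' : I → I),
      Enumerates (Sg I X₁) k x → Enumerates (Sg I X₂) l y → FreshWitnesses a b x y w w' →
      ∀ H₁ H₂ : Set B,
      H₁ = filterGen (Sg I X₁) (witnessSet a k x w) →
      H₂ = filterGen (Sg I X₂) (witnessSet (∼ₘb) l y w') →
      (commonFilter (Sg I (X₁ ∩ X₂)) H₁ H₂ ≠ Sg I (X₁ ∩ X₂) →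
        ∃ Hs F₁ F₂ : Set B,
          IsFilterTriple (Sg I (X₁ ∩ X₂)) (Sg I X₁) (Sg I X₂) H₁ H₂ Hs F₁ F₂) ∧
      ∀ Hs F₁ F₂ : Set B,
        IsFilterTriple (Sg I (X₁ ∩ X₂)) (Sg I X₁) (Sg I X₂) H₁ H₂ Hs F₁ F₂ →
        IsHenkin I (Sg I X₁) F₁ ∧ IsHenkin I (Sg I X₂) F₂ ∧
        IsHomOn I (Sg I X₁) (psi F₁ : B → FunAlg I) ∧
        IsHomOn I (Sg I X₂) (psi F₂ : B → FunAlg I) ∧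
        (∀ c ∈ Sg I (X₁ ∩ X₂), truthValue F₁ c = truthValue F₂ c) ∧
        (∀ c ∈ Sg I (X₁ ∩ X₂), (psi F₁ c : FunAlg I) = psi F₂ c)) := by
  refine ⟨fun P hP hH => isHomOn_psi hB hP isSubuniverse_univ hH, ?_⟩
  intro X₁ X₂ a _ b _ k l x y w w' hx hy hfresh H₁ H₂ hH₁ hH₂
  have hS₁ := isSubuniverse_Sg (I := I) X₁
  have hS₂ := isSubuniverse_Sg (I := I) X₂
  have hS₀ := isSubuniverse_Sg (I := I) (X₁ ∩ X₂)
  have hsub₁ : Sg I (X₁ ∩ X₂) ⊆ Sg I X₁ := Sg_mono Set.inter_subset_left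
  have hsub₂ : Sg I (X₁ ∩ X₂) ⊆ Sg I X₂ := Sg_mono Set.inter_subset_right
  constructor
  · intro hne
    have hC := isFilterOf_filterGen hS₀ ((H₁ ∩ Sg I (X₁ ∩ X₂)) ∪ (H₂ ∩ Sg I (X₁ ∩ X₂)))
    obtain ⟨Hs, hM, hle⟩ := hC.exists_maximal hS₀ fun h => hne (hC.eq_of_zero_mem h)
    obtain ⟨F₁, hF₁, hF₁'⟩ := hM.exists_extension hS₁ hS₀ hsub₁
      (H := H₁) (by rw [hH₁]; exact isFilterOf_filterGen hS₁ _)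
      (fun z hz => hle (mem_filterGen (Or.inl hz) hz.2))
    obtain ⟨F₂, hF₂, hF₂'⟩ := hM.exists_extension hS₂ hS₀ hsub₂
      (H := H₂) (by rw [hH₂]; exact isFilterOf_filterGen hS₂ _)
      (fun z hz => hle (mem_filterGen (Or.inr hz) hz.2))
    exact ⟨Hs, F₁, F₂, hM, hle, hF₁, hF₁', hF₂, hF₂'⟩
  · rintro Hs F₁ F₂ ⟨hM, -, hF₁, hF₁', hF₂, hF₂'⟩
    -- The union in the freshness condition runs over `j ≤ i`, so it includes `j = i`.
    have hw : ∀ i, w i ∉ dimSet I (x i) := fun i h =>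
      hfresh.1 i (Or.inl (Or.inl (Or.inr (Set.mem_iUnion₂.2 ⟨i, le_rfl, Or.inl h⟩))))
    have hw' : ∀ i, w' i ∉ dimSet I (y i) := fun i h =>
      hfresh.2 i (Or.inl (Or.inl (Or.inr (Set.mem_iUnion₂.2 ⟨i, le_rfl, Or.inr h⟩))))
    have hHk₁ : IsHenkin I (Sg I X₁) F₁ := isHenkin_of_witnessSet hS₁ hF₁ hx hw
      (hH₁ ▸ Set.subset_union_left.trans hF₁')
    have hHk₂ : IsHenkin I (Sg I X₂) F₂ := isHenkin_of_witnessSet hS₂ hF₂ hy hw'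
      (hH₂ ▸ Set.subset_union_left.trans hF₂')
    have hiff : ∀ c ∈ Sg I (X₁ ∩ X₂), c ∈ F₁ ↔ c ∈ F₂ := fun c hc =>
      (hM.mem_iff_of_subset hS₀ hsub₁ hF₁ (Set.subset_union_right.trans hF₁') hc).trans
        (hM.mem_iff_of_subset hS₀ hsub₂ hF₂ (Set.subset_union_right.trans hF₂') hc).symm
    exact ⟨hHk₁, hHk₂, isHomOn_psi hB hF₁ hS₁ hHk₁, isHomOn_psi hB hF₂ hS₂ hHk₂,
      fun c hc => truthValue_eq_of_mem_iff hS₀ hiff hc,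
      fun c hc => funext fun x => truthValue_eq_of_mem_iff hS₀ hiff (substOp_mem hS₀ x hc)⟩
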